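/- Let $\omega=\omega_1\omega_2\ldots$ be a sequence in $\{0,1,2\}^\infty$ without repetition, i.e. $\omega_i\neq\omega_{i+1}$ for every $i$. Let $G_\omega$ be the Grigorchuk group: the group of automorphisms of the infinite binary rooted tree generated by $a,b_\omega,c_\omega,d_\omega$, where, for all binary words $x$, \[ a(0x)=1x,\qquad a(1x)=0x,\qquad s_\omega(1x)=1\,s_{\sigma\omega}(x),\qquad s_\omega(0x)=\begin{cases}0x & \text{if }\omega_1=i(s),\\ 0\,a(x)&\text{if }\omega_1\neq i(s),\end{cases}\qquad s\in\{b,c,d\}, \] with $i(b)=2$, $i(c)=1$, $i(d)=0$ and $\sigma$ the shift. The group $G_\omega$ acts on the infinite binary sequences, i.e. on the boundary of the tree; let $V$ be the orbit of $0^\infty$, which is the set of sequences with finitely many digits $1$, and let $\Gamma$ be the orbital graph on $V$ (without labels it does not depend on $\omega$). Let $\Gamma_+\subset V$ consist of $0^\infty$ and of the vertices that can be joined to $10^\infty$ by a path in $\Gamma$ avoiding $0^\infty$. Let $\mathcal{X}$ be the following cube complex. Its vertices are the subsets of $V$ whose symmetric difference with $\Gamma_+$ is finite; equivalently, they form the connected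 component of $\Gamma_+$ in the graph on the subsets of $V$ in which two subsets are joined by an edge when they differ by exactly one element. For every vertex $v$ and every finite set $F\subset V$ it has the cube, with edges of length one, spanned by the $2^{|F|}$ vertices that differ from $v$ only on $F$. Equip $\mathcal{X}$ with the path metric induced by the Euclidean metrics of its cubes and with the action of $G_\omega$ that extends the action $v\mapsto gv$ on vertices and is affine on cubes. Then $\mathcal{X}$ is a model for $\underline{E}G_\omega$, the classifying space of proper actions of the discrete group $G_\omega$. This means the following. An action of a discrete group $G$ by homeomorphisms on a space $Z$ is called proper if every point of $Z$ has a $G$-invariant open neighbourhood that admits a continuous $G$-equivariant map to $G/K$, with the discrete topology, for some finite subgroup $K$ of $G$. Then: 1. the action of $G_\omega$ on $\mathcal{X}$ is proper, and $\mathcal{X}$ and $G_\omega\backslash\mathcal{X}$ are metrizable; 2. for every space $Z$ with a proper action of $G_\omega$ and paracompact Hausdorff quotient $G_\omega\backslash Z$ (for example, $Z$ and $G_\omega\backslash Z$ metrizable), there is a continuous $G_\omega$-equivariant map $Z\to\mathcal{X}$; 3. for every such $Z$, any two continuous $G_\omega$-equivariant maps $Z\to\mathcal{X}$ are homotopic through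 $G_\omega$-equivariant maps. -/

import Mathlib

universe u v w

namespace GrigorchukCube

open scoped symmDiff

/-! ## The binary rooted tree, its boundary, and the Grigorchuk groups -/

/-- Automorphisms of the infinite binary rooted tree. The vertices of the tree are the finite binary
words (`false` is the letter `0`, `true` is the letter `1`), the level of a vertex is its length, and
`u` lies above `v` when `u` is a prefix of `v`. -/
def TreeAut : Subgroup (Equiv.Perm (List Bool)) where
  carrier := {g | (∀ u, (g u).length = u.length) ∧ ∀ u v, g u <+: g v ↔ u <+: v}
  one_mem' := by simp
  mul_mem' := by
    rintro g h ⟨hg, hg'⟩ ⟨hh, hh'⟩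
    refine ⟨fun u => ?_, fun u v => ?_⟩
    · rw [Equiv.Perm.mul_apply, hg, hh]
    · rw [Equiv.Perm.mul_apply, Equiv.Perm.mul_apply, hg', hh']
  inv_mem' := by
    rintro g ⟨hg, hg'⟩
    have h : ∀ u, g (g⁻¹ u) = u := fun u => g.apply_symm_apply u
    refine ⟨fun u => ?_, fun u v => ?_⟩
    · rw [← hg, h]
    · rw [← hg', h, h]

/-- The boundary of the tree: infinite binary sequences. -/
def Boundary : Type := ℕ → Bool

/-- The prefix of length `n` of an infinite sequence. -/
def pref (x : Boundary) (n : ℕ) : List Bool := (List.range n).map fun i => x i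

theorem length_pref (x : Boundary) (n : ℕ) : (pref x n).length = n := by
  simp [pref]

theorem pref_prefix (x : Boundary) {m n : ℕ} (h : m ≤ n) : pref x m <+: pref x n := by
  obtain ⟨k, rfl⟩ := Nat.exists_eq_add_of_le h
  unfold pref
  rw [List.range_add, List.map_append]
  exact List.prefix_append _ _

theorem getD_pref (x : Boundary) {n i : ℕ} (h : i < n) : (pref x n).getD i false = x i := by
  simp [pref, List.getD_eq_getElem?_getD, h]

theorem getD_of_prefix {u v : List Bool} (h : u <+: v) {i : ℕ} (hi : i < u.length) :
    u.getD i false = v.getD i false := by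
  obtain ⟨w, rfl⟩ := h
  simp [List.getD_eq_getElem?_getD, List.getElem?_append_left hi]

/-- Tree automorphisms act on the boundary: the prefix of length `n` of `g • x` is the image under
`g` of the prefix of length `n` of `x` (see `pref_smul`). -/
instance : SMul TreeAut Boundary :=
  ⟨fun g x n => (g.1 (pref x (n + 1))).getD n false⟩

theorem smul_apply (g : TreeAut) (x : Boundary) (n : ℕ) :
    (g • x) n = (g.1 (pref x (n + 1))).getD n false := rfl

theorem pref_smul (g : TreeAut) (x : Boundary) (n : ℕ) : pref (g • x) n = g.1 (pref x n) := by
  have hl : (g.1 (pref x n)).length = n := by rw [g.2.1, length_pref]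
  apply List.ext_getElem
  · rw [length_pref, hl]
  · intro i h1 h2
    rw [length_pref] at h1
    have e1 : (pref (g • x) n).getD i false = (g • x) i := getD_pref _ h1
    have e2 : (g.1 (pref x (i + 1))).getD i false = (g.1 (pref x n)).getD i false := by
      apply getD_of_prefix
      · exact (g.2.2 _ _).2 (pref_prefix x h1)
      · rw [g.2.1, length_pref]; omega
    rw [smul_apply, e2] at e1
    rw [List.getD_eq_getElem _ _ h2,
      List.getD_eq_getElem _ _ (by rw [length_pref]; exact h1)] at e1
    exact e1

instance : MulAction TreeAut Boundary where
  one_smul x := by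
    funext n
    rw [smul_apply]
    exact getD_pref x (Nat.lt_succ_self n)
  mul_smul g h x := by
    funext n
    rw [smul_apply, smul_apply, pref_smul]
    rfl

/-- The automorphism `a` on words: it flips the first letter. -/
def aFun : List Bool → List Bool
  | [] => []
  | b :: w => (!b) :: w

/-- The shift of a sequence. -/
def shift (ω : ℕ → Fin 3) : ℕ → Fin 3 := fun n => ω (n + 1)

/-- The automorphisms `b_ω` (for `i = 2`), `c_ω` (for `i = 1`) and `d_ω` (for `i = 0`) on words. -/
def genFun (i : Fin 3) : (ℕ → Fin 3) → List Bool → List Bool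
  | _, [] => []
  | ω, false :: w => if ω 0 = i then false :: w else false :: aFun w
  | ω, true :: w => true :: genFun i (shift ω) w

theorem aFun_aFun (w : List Bool) : aFun (aFun w) = w := by
  cases w <;> simp [aFun]

theorem length_aFun (w : List Bool) : (aFun w).length = w.length := by
  cases w <;> simp [aFun]

theorem aFun_prefix {u v : List Bool} (h : u <+: v) : aFun u <+: aFun v := by
  obtain ⟨w, rfl⟩ := h
  cases u with
  | nil => simp [aFun]
  | cons b u => simp [aFun]

theorem genFun_genFun (i : Fin 3) (ω : ℕ → Fin 3) (w : List Bool) :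
    genFun i ω (genFun i ω w) = w := by
  induction w generalizing ω with
  | nil => simp [genFun]
  | cons b w ih =>
    cases b with
    | false => by_cases h : ω 0 = i <;> simp [genFun, h, aFun_aFun]
    | true => simp [genFun, ih]

theorem length_genFun (i : Fin 3) (ω : ℕ → Fin 3) (w : List Bool) :
    (genFun i ω w).length = w.length := by
  induction w generalizing ω with
  | nil => simp [genFun]
  | cons b w ih =>
    cases b with
    | false => by_cases h : ω 0 = i <;> simp [genFun, h, length_aFun]
    | true => simp [genFun, ih]

theorem genFun_prefix (i : Fin 3) (ω : ℕ → Fin 3) {u v : List Bool} (h : u <+: v) :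
    genFun i ω u <+: genFun i ω v := by
  induction u generalizing ω v with
  | nil => simp [genFun]
  | cons b u ih =>
    obtain ⟨w, rfl⟩ := h
    have hu : u <+: u ++ w := List.prefix_append u w
    cases b with
    | false =>
      by_cases h : ω 0 = i
      · simp [genFun, h]
      · simpa [genFun, h] using aFun_prefix hu
    | true => simpa [genFun] using ih (shift ω) hu

/-- The automorphism `a` of the tree. -/
def aAut : TreeAut :=
  ⟨⟨aFun, aFun, aFun_aFun, aFun_aFun⟩, length_aFun, fun u v =>
    ⟨fun h => by simpa [aFun_aFun] using aFun_prefix h, aFun_prefix⟩⟩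

/-- The automorphisms `b_ω` (`i = 2`), `c_ω` (`i = 1`), `d_ω` (`i = 0`) of the tree. -/
def genAut (i : Fin 3) (ω : ℕ → Fin 3) : TreeAut :=
  ⟨⟨genFun i ω, genFun i ω, genFun_genFun i ω, genFun_genFun i ω⟩, length_genFun i ω, fun u v =>
    ⟨fun h => by simpa [genFun_genFun] using genFun_prefix i ω h, genFun_prefix i ω⟩⟩

/-- The generating set `{a, b_ω, c_ω, d_ω}`. -/
def gens (ω : ℕ → Fin 3) : Set TreeAut := {aAut, genAut 2 ω, genAut 1 ω, genAut 0 ω}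

/-- The Grigorchuk group `G_ω`. -/
def G (ω : ℕ → Fin 3) : Subgroup TreeAut := Subgroup.closure (gens ω)

theorem gens_mul_self {ω : ℕ → Fin 3} {s : TreeAut} (hs : s ∈ gens ω) : s * s = 1 := by
  simp only [gens, Set.mem_insert_iff, Set.mem_singleton_iff] at hs
  rcases hs with rfl | rfl | rfl | rfl
  · exact Subtype.ext (Equiv.ext aFun_aFun)
  all_goals exact Subtype.ext (Equiv.ext (genFun_genFun _ ω))

theorem gens_smul_smul {ω : ℕ → Fin 3} {s : TreeAut} (hs : s ∈ gens ω) (x : Boundary) :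
    s • s • x = x := by
  rw [smul_smul, gens_mul_self hs, one_smul]

/-- The sequence `x` with its letter at position `k` flipped. -/
def flip (k : ℕ) (x : Boundary) : Boundary := fun n => if n = k then !(x n) else x n

/-- The sequence `x` without its first letter. -/
def tail (x : Boundary) : Boundary := fun n => x (n + 1)

theorem pref_succ (x : Boundary) (n : ℕ) : pref x (n + 1) = x 0 :: pref (tail x) n := by
  unfold pref
  rw [List.range_succ_eq_map, List.map_cons, List.map_map]
  rfl

theorem aAut_smul (x : Boundary) : aAut • x = flip 0 x := by
  funext n
  have h : (aAut • x) n = (aFun (pref x (n + 1))).getD n false := rfl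
  rw [h, pref_succ]
  cases n with
  | zero => simp [aFun, flip]
  | succ n =>
    simp only [aFun, List.getD_cons_succ, flip, Nat.succ_ne_zero, if_false]
    exact getD_pref (tail x) (Nat.lt_succ_self n)

theorem genAut_smul_zero (i : Fin 3) (ω : ℕ → Fin 3) (x : Boundary) :
    (genAut i ω • x) 0 = x 0 := by
  have h : (genAut i ω • x) 0 = (genFun i ω (pref x 1)).getD 0 false := rfl
  rw [h, pref_succ]
  cases hx : x 0
  · by_cases h : ω 0 = i <;> simp [genFun, h]
  · simp [genFun]

theorem genAut_smul_of_true (i : Fin 3) (ω : ℕ → Fin 3) (x : Boundary) (hx : x 0 = true) :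
    tail (genAut i ω • x) = genAut i (shift ω) • tail x := by
  funext n
  have h : tail (genAut i ω • x) n = (genFun i ω (pref x (n + 2))).getD (n + 1) false := rfl
  rw [h, pref_succ, hx]
  rfl

theorem genAut_smul_of_false (i : Fin 3) (ω : ℕ → Fin 3) (x : Boundary) (hx : x 0 = false) :
    tail (genAut i ω • x) = if ω 0 = i then tail x else flip 0 (tail x) := by
  funext n
  have h : tail (genAut i ω • x) n = (genFun i ω (pref x (n + 2))).getD (n + 1) false := rfl
  rw [h, pref_succ, hx]
  by_cases h : ω 0 = i
  · simpa [genFun, h] using getD_pref (tail x) (Nat.lt_succ_self n)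
  · rw [if_neg h, ← aAut_smul]
    simp only [genFun, h, if_false, List.getD_cons_succ]
    rfl

theorem boundary_ext {x y : Boundary} (h0 : x 0 = y 0) (h : tail x = tail y) : x = y := by
  funext n
  cases n with
  | zero => exact h0
  | succ n => exact congrFun h n

theorem tail_flip (k : ℕ) (x : Boundary) : tail (flip (k + 1) x) = flip k (tail x) := by
  funext n
  simp [tail, flip]

/-- `k` is the position of the first letter `0` of `x`. -/
def FirstZero (x : Boundary) (k : ℕ) : Prop := (∀ j < k, x j = true) ∧ x k = false

theorem genAut_smul (i : Fin 3) (ω : ℕ → Fin 3) {x : Boundary} {k : ℕ} (h : FirstZero x k) :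
    genAut i ω • x = if ω k = i then x else flip (k + 1) x := by
  induction k generalizing ω x with
  | zero =>
    apply boundary_ext
    · rw [genAut_smul_zero]; split_ifs <;> simp [flip]
    · rw [genAut_smul_of_false i ω x h.2]
      split_ifs
      · rfl
      · rw [tail_flip]
  | succ k ih =>
    have h' : FirstZero (tail x) k := ⟨fun j hj => h.1 (j + 1) (by omega), h.2⟩
    apply boundary_ext
    · rw [genAut_smul_zero]; split_ifs <;> simp [flip]
    · rw [genAut_smul_of_true i ω x (h.1 0 (by omega)), ih (shift ω) h']
      have : shift ω k = ω (k + 1) := rfl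
      rw [this]
      split_ifs
      · rfl
      · rw [tail_flip]

theorem exists_firstZero {x : Boundary} (h : {n | x n = true}.Finite) : ∃ k, FirstZero x k := by
  classical
  have h2 : ∃ k, x k = false := by
    by_contra hc
    push Not at hc
    have : {n | x n = true} = Set.univ := by
      ext n; simpa using hc n
    rw [this] at h
    exact Set.infinite_univ h
  refine ⟨Nat.find h2, fun j hj => ?_, Nat.find_spec h2⟩
  simpa using Nat.find_min h2 hj

theorem flip_finite (k : ℕ) {x : Boundary} (h : {n | x n = true}.Finite) :
    {n | flip k x n = true}.Finite := by
  apply (h.union (Set.finite_singleton k)).subset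
  intro n hn
  by_cases hk : n = k
  · right; exact hk
  · left; simpa [flip, hk] using hn

theorem flip_flip (k : ℕ) (x : Boundary) : flip k (flip k x) = x := by
  funext n
  by_cases h : n = k <;> simp [flip, h]

theorem flip_ne (k : ℕ) (x : Boundary) : flip k x ≠ x := by
  intro h
  have := congrFun h k
  simp [flip] at this

theorem gens_finite {ω : ℕ → Fin 3} {s : TreeAut} (hs : s ∈ gens ω) {x : Boundary}
    (h : {n | x n = true}.Finite) : {n | (s • x) n = true}.Finite := by
  obtain ⟨k, hk⟩ := exists_firstZero h
  simp only [gens, Set.mem_insert_iff, Set.mem_singleton_iff] at hs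
  rcases hs with rfl | rfl | rfl | rfl
  · rw [aAut_smul]; exact flip_finite 0 h
  all_goals
    rw [genAut_smul _ ω hk]
    split_ifs
    · exact h
    · exact flip_finite _ h

theorem smul_finite {ω : ℕ → Fin 3} {g : TreeAut} (hg : g ∈ G ω) :
    ∀ {x : Boundary}, {n | x n = true}.Finite → {n | (g • x) n = true}.Finite := by
  refine Subgroup.closure_induction'' (p := fun g _ => ∀ {x : Boundary},
    {n | x n = true}.Finite → {n | (g • x) n = true}.Finite) ?_ ?_ ?_ ?_ hg
  · intro s hs x hx
    exact gens_finite hs hx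
  · intro s hs x hx
    rw [inv_eq_of_mul_eq_one_left (gens_mul_self hs)]
    exact gens_finite hs hx
  · intro x hx
    rwa [one_smul]
  · intro g h _ _ ihg ihh x hx
    rw [mul_smul]
    exact ihg (ihh hx)

/-! ## The graph `Γ` and the half-line `Γ₊` -/

/-- The vertices of `Γ`: the infinite binary sequences with finitely many `1`. This is the orbit of
`0^∞` under `G_ω`, for every `ω` (see `orbit_zeroSeq`). -/
def V : Type := {x : Boundary // {n | x n = true}.Finite}

instance (ω : ℕ → Fin 3) : MulAction (G ω) V where
  smul g x := ⟨g.1 • x.1, smul_finite g.2 x.2⟩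
  one_smul x := Subtype.ext (one_smul TreeAut x.1)
  mul_smul g h x := Subtype.ext (mul_smul g.1 h.1 x.1)

/-- The sequence `0^∞`. -/
def zeroSeq : V := ⟨fun _ => false, by simp⟩

/-- Flipping one letter of a vertex of `Γ`. -/
def V.flip (k : ℕ) (x : V) : V := ⟨GrigorchukCube.flip k x.1, flip_finite k x.2⟩

/-- The sequence `10^∞`. -/
def oneSeq : V := V.flip 0 zeroSeq

/-- The orbital graph of `G_ω` acting on the orbit of `0^∞`, without labels, loops and multiple
edges. -/
def orbitalGraph (ω : ℕ → Fin 3) : SimpleGraph V where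
  Adj x y := x ≠ y ∧ ∃ s ∈ gens ω, s • x.1 = y.1
  symm := ⟨by
    rintro x y ⟨h, s, hs, e⟩
    exact ⟨h.symm, s, hs, by rw [← e, gens_smul_smul hs]⟩⟩
  loopless := ⟨fun _ h => h.1 rfl⟩

/-- The graph `Γ`: two vertices are joined by an edge if they differ exactly in the first letter, or
exactly in the letter that follows the first `0`. This is the common orbital graph of all the groups
`G_ω` (see `orbitalGraph_eq`). -/
def Γ : SimpleGraph V where
  Adj x y := y = V.flip 0 x ∨ ∃ k, FirstZero x.1 k ∧ y = V.flip (k + 1) x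
  symm := ⟨by
    rintro x y (rfl | ⟨k, hk, rfl⟩)
    · left; exact (Subtype.ext (flip_flip 0 x.1)).symm
    · right
      refine ⟨k, ⟨fun j hj => ?_, ?_⟩, (Subtype.ext (flip_flip (k + 1) x.1)).symm⟩
      · have : j ≠ k + 1 := by omega
        simpa [V.flip, GrigorchukCube.flip, this] using hk.1 j hj
      · simpa [V.flip, GrigorchukCube.flip] using hk.2⟩
  loopless := ⟨by
    rintro x (h | ⟨k, -, h⟩)
    · exact flip_ne _ _ (congrArg Subtype.val h).symm
    · exact flip_ne _ _ (congrArg Subtype.val h).symm⟩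

theorem exists_gen_ne (j : Fin 3) : ∃ i : Fin 3, j ≠ i := ⟨j + 1, by revert j; decide⟩

theorem genAut_mem (i : Fin 3) (ω : ℕ → Fin 3) : genAut i ω ∈ gens ω := by
  fin_cases i <;> simp [gens]

/-- For every `ω`, the orbital graph of `G_ω` is `Γ`. -/
theorem orbitalGraph_eq (ω : ℕ → Fin 3) : orbitalGraph ω = Γ := by
  ext x y
  constructor
  · rintro ⟨hne, s, hs, e⟩
    obtain ⟨k, hk⟩ := exists_firstZero x.2
    simp only [gens, Set.mem_insert_iff, Set.mem_singleton_iff] at hs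
    rcases hs with rfl | rfl | rfl | rfl
    · left; exact Subtype.ext (by rw [← e, aAut_smul]; rfl)
    all_goals
      right
      rw [genAut_smul _ ω hk] at e
      split_ifs at e
      · exact absurd (Subtype.ext e) hne
      · exact ⟨k, hk, Subtype.ext e.symm⟩
  · intro h
    refine ⟨h.ne, ?_⟩
    rcases h with rfl | ⟨k, hk, rfl⟩
    · exact ⟨aAut, by simp [gens], aAut_smul _⟩
    · obtain ⟨i, hi⟩ := exists_gen_ne (ω k)
      refine ⟨genAut i ω, genAut_mem i ω, ?_⟩
      rw [genAut_smul _ ω hk, if_neg hi]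
      rfl

theorem smul_adj_or_eq {ω : ℕ → Fin 3} {s : G ω} (hs : s.1 ∈ gens ω) (x : V) :
    s • x = x ∨ Γ.Adj x (s • x) := by
  by_cases h : s • x = x
  · exact Or.inl h
  · right
    rw [← orbitalGraph_eq ω]
    exact ⟨fun e => h e.symm, s.1, hs, rfl⟩

theorem reachable_of_agree (n : ℕ) : ∀ x y : V, (∀ m, n ≤ m → x.1 m = y.1 m) →
    Γ.Reachable x y := by
  induction n with
  | zero =>
    intro x y h
    have : x = y := Subtype.ext (funext fun m => h m (Nat.zero_le m))
    rw [this]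
  | succ n ih =>
    intro x y h
    by_cases hn : x.1 n = y.1 n
    · apply ih
      intro m hm
      rcases Nat.eq_or_lt_of_le hm with rfl | hm
      · exact hn
      · exact h m hm
    · rcases Nat.eq_zero_or_pos n with rfl | hpos
      · have : y = V.flip 0 x := by
          apply Subtype.ext
          funext m
          by_cases hm : m = 0
          · subst hm
            show y.1 0 = GrigorchukCube.flip 0 x.1 0
            simp only [GrigorchukCube.flip, if_true]
            revert hn
            cases x.1 0 <;> cases y.1 0 <;> simp
          · show y.1 m = GrigorchukCube.flip 0 x.1 m
            simp only [GrigorchukCube.flip, hm, if_false]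
            exact (h m (by omega)).symm
        exact SimpleGraph.Adj.reachable (Or.inl this)
      · obtain ⟨k, rfl⟩ : ∃ k, n = k + 1 := ⟨n - 1, by omega⟩
        have hfin : {m | (fun m => if m < k then true else if m = k then false else x.1 m :
            Boundary) m = true}.Finite := by
          apply ((Set.finite_lt_nat k).union x.2).subset
          intro m hm
          by_cases h1 : m < k
          · exact Or.inl h1
          · right
            by_cases h2 : m = k
            · simp [h2] at hm
            · simpa [h1, h2] using hm
        let z : V := ⟨fun m => if m < k then true else if m = k then false else x.1 m, hfin⟩
        have hz : FirstZero z.1 k := by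
          refine ⟨fun j hj => ?_, ?_⟩
          · show (if j < k then true else if j = k then false else x.1 j) = true
            simp [hj]
          · show (if k < k then true else if k = k then false else x.1 k) = false
            simp
        have h1 : Γ.Reachable x z := by
          apply ih
          intro m hm
          show x.1 m = if m < k then true else if m = k then false else x.1 m
          have a1 : ¬ m < k := by omega
          have a2 : ¬ m = k := by omega
          simp [a1, a2]
        have h2 : Γ.Reachable z (V.flip (k + 1) z) :=
          SimpleGraph.Adj.reachable (Or.inr ⟨k, hz, rfl⟩)
        have h3 : Γ.Reachable (V.flip (k + 1) z) y := by
          apply ih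
          intro m hm
          show (if m = k + 1 then !(if m < k then true else if m = k then false else x.1 m)
            else if m < k then true else if m = k then false else x.1 m) = y.1 m
          have a1 : ¬ m < k := by omega
          have a2 : ¬ m = k := by omega
          by_cases hmk : m = k + 1
          · subst hmk
            simp only [a1, a2, if_true, if_false]
            revert hn
            cases x.1 (k + 1) <;> cases y.1 (k + 1) <;> simp
          · simp only [a1, a2, hmk, if_false]
            exact h m (by omega)
        exact (h1.trans h2).trans h3

/-- The orbit of `0^∞` under `G_ω` consists of all the sequences with finitely many `1`. -/
theorem orbit_zeroSeq (ω : ℕ → Fin 3) : MulAction.orbit (G ω) zeroSeq = Set.univ := by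
  apply Set.eq_univ_of_forall
  intro x
  have hx : Γ.Reachable zeroSeq x := by
    obtain ⟨n, hn⟩ := x.2.bddAbove
    apply reachable_of_agree (n + 1)
    intro m hm
    show false = x.1 m
    by_contra hc
    have : x.1 m = true := by simpa using (Ne.symm hc)
    have := hn this
    omega
  obtain ⟨p⟩ := hx
  have : ∀ {u v : V}, Γ.Walk u v → u ∈ MulAction.orbit (G ω) zeroSeq →
      v ∈ MulAction.orbit (G ω) zeroSeq := by
    intro u v p
    induction p with
    | nil => exact id
    | cons h _ ih =>
      intro hu
      apply ih
      rw [← orbitalGraph_eq ω] at h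
      obtain ⟨-, s, hs, e⟩ := h
      obtain ⟨g, rfl⟩ := hu
      exact ⟨⟨s, Subgroup.subset_closure hs⟩ * g, by
        show (_ * g) • zeroSeq = _
        rw [mul_smul]
        exact Subtype.ext e⟩
  exact this p (MulAction.mem_orbit_self _)

/-- The set `Γ₊`: the vertex `0^∞` and all the vertices on its right side, the side of `10^∞`, that
is, the vertices joined to `10^∞` by a path that avoids `0^∞`. -/
def ΓPlus : Set V := {x | x = zeroSeq ∨ ∃ p : Γ.Walk oneSeq x, zeroSeq ∉ p.support}

/-! ## The cube complex `X` -/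

/-- The graph of 2-colorings of the vertices of `Γ`. A coloring is given by its support, the set of
vertices of `Γ` that have color `1`; two colorings are joined by an edge if they differ on exactly
one vertex of `Γ`. -/
def coloringGraph : SimpleGraph (Set V) where
  Adj v w := ∃ x, v ∆ w = {x}
  symm := ⟨by
    rintro v w ⟨x, h⟩
    exact ⟨x, by rw [symmDiff_comm, h]⟩⟩
  loopless := ⟨by
    rintro v ⟨x, h⟩
    rw [symmDiff_self] at h
    exact Set.singleton_ne_empty x h.symm⟩

/-- The vertices of `X`: the colorings in the connected component of the coloring with support
`Γ₊`. -/
def IsVertex (v : Set V) : Prop := coloringGraph.Reachable ΓPlus v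

/-- The cube `C(v, x₁, …, xₙ)`, where `F = {x₁, …, xₙ}`, spanned by the `2 ^ n` colorings that
differ from `v` only on `F`. A point of the cube has a coordinate in `[0, 1]` for every element of
`F`; these are recorded as a function on all of `V(Γ)` whose values off `F` are the colors of `v`.
Thus the vertices of the cube are its `{0, 1}`-valued functions, and two cubes are glued exactly
along their common face. -/
def cube (v : Set V) (F : Finset V) : Set (V → ℝ) :=
  {φ | (∀ x, φ x ∈ Set.Icc (0 : ℝ) 1) ∧ ∀ x ∉ F, φ x = v.indicator 1 x}

/-- The cube complex `X`: the union of the cubes spanned by its vertices. -/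
def X : Type := {φ : V → ℝ // ∃ (v : Set V) (F : Finset V), IsVertex v ∧ φ ∈ cube v F}

theorem finite_of_reachable {v w : Set V} (h : coloringGraph.Reachable v w) : (v ∆ w).Finite := by
  obtain ⟨p⟩ := h
  induction p with
  | nil => simp
  | cons h _ ih =>
    obtain ⟨x, hx⟩ := h
    exact ((hx ▸ Set.finite_singleton x).union ih).subset (symmDiff_triangle _ _ _)

theorem reachable_of_finite {v w : Set V} (h : (v ∆ w).Finite) : coloringGraph.Reachable v w := by
  have key : ∀ S : Set V, S.Finite → ∀ v : Set V, coloringGraph.Reachable v (v ∆ S) := by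
    intro S hS
    induction S, hS using Set.Finite.induction_on with
    | empty => intro v; rw [← Set.bot_eq_empty, symmDiff_bot]
    | @insert x S hx _ ih =>
      intro v
      refine (ih v).trans (SimpleGraph.Adj.reachable ⟨x, ?_⟩)
      ext y
      simp only [Set.mem_symmDiff, Set.mem_insert_iff, Set.mem_singleton_iff]
      by_cases hy : y = x
      · subst hy; tauto
      · tauto
  have := key _ h v
  rwa [symmDiff_symmDiff_cancel_left] at this

/-- The points of `X` are the functions with values in `[0, 1]` that differ from the indicator
function of `Γ₊` at finitely many places. -/
theorem mem_X_iff (φ : V → ℝ) : (∃ (v : Set V) (F : Finset V), IsVertex v ∧ φ ∈ cube v F) ↔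
    (∀ x, φ x ∈ Set.Icc (0 : ℝ) 1) ∧ {x | φ x ≠ ΓPlus.indicator 1 x}.Finite := by
  constructor
  · rintro ⟨v, F, hv, h1, h2⟩
    refine ⟨h1, ((finite_of_reachable hv).union F.finite_toSet).subset ?_⟩
    intro x hx
    by_contra hc
    simp only [Set.mem_union, not_or, Set.mem_symmDiff, SetLike.mem_coe] at hc
    apply hx
    rw [h2 x hc.2]
    by_cases hxv : x ∈ v
    · have : x ∈ ΓPlus := by_contra fun h => hc.1.2 ⟨hxv, h⟩
      simp [hxv, this]
    · have : x ∉ ΓPlus := fun h => hc.1.1 ⟨h, hxv⟩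
      simp [hxv, this]
  · rintro ⟨h1, h2⟩
    refine ⟨ΓPlus, h2.toFinset, SimpleGraph.Reachable.refl _, h1, ?_⟩
    intro x hx
    by_contra hc
    exact hx (h2.mem_toFinset.2 hc)

/-- Two points of `X` lie in a common cube of `X`. -/
def InCommonCube (φ ψ : X) : Prop :=
  ∃ (v : Set V) (F : Finset V), IsVertex v ∧ φ.1 ∈ cube v F ∧ ψ.1 ∈ cube v F

/-- The Euclidean distance of two points of a common cube: there, all but finitely many terms of
the sum are zero. -/
noncomputable def euclid (φ ψ : V → ℝ) : ℝ := Real.sqrt (∑ᶠ x, (φ x - ψ x) ^ 2)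

/-- The lengths of the strings from `φ` to `ψ`: a string is a finite sequence of points of `X` in
which consecutive points lie in a common cube, and its length is the sum of the Euclidean distances
of consecutive points. -/
def stringLengths (φ ψ : X) : Set ℝ :=
  {L | ∃ (m : ℕ) (p : ℕ → X), p 0 = φ ∧ p m = ψ ∧ (∀ i < m, InCommonCube (p i) (p (i + 1))) ∧
    L = ∑ i ∈ Finset.range m, euclid (p i).1 (p (i + 1)).1}

theorem finite_ne (φ ψ : X) : {x | φ.1 x ≠ ψ.1 x}.Finite := by
  apply (((mem_X_iff _).1 φ.2).2.union ((mem_X_iff _).1 ψ.2).2).subset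
  intro x hx
  by_contra hc
  simp only [Set.mem_union, Set.mem_ofPred_eq, not_or, not_not] at hc
  exact hx (hc.1.trans hc.2.symm)

theorem inCommonCube (φ ψ : X) : InCommonCube φ ψ := by
  classical
  have h1 := (mem_X_iff _).1 φ.2
  have h2 := (mem_X_iff _).1 ψ.2
  refine ⟨ΓPlus, h1.2.toFinset ∪ h2.2.toFinset, SimpleGraph.Reachable.refl _,
    ⟨h1.1, fun x hx => ?_⟩, ⟨h2.1, fun x hx => ?_⟩⟩
  · by_contra hc
    exact hx (Finset.mem_union_left _ (h1.2.mem_toFinset.2 hc))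
  · by_contra hc
    exact hx (Finset.mem_union_right _ (h2.2.mem_toFinset.2 hc))

theorem euclid_eq (φ ψ : X) (F : Finset V) (hF : ∀ x, φ.1 x ≠ ψ.1 x → x ∈ F) :
    euclid φ.1 ψ.1 = dist (WithLp.toLp 2 fun x : F => φ.1 x : EuclideanSpace ℝ F)
      (WithLp.toLp 2 fun x : F => ψ.1 x) := by
  rw [EuclideanSpace.dist_eq, euclid]
  congr 1
  rw [finsum_eq_sum_of_support_subset (s := F)]
  · rw [← Finset.sum_coe_sort]
    apply Finset.sum_congr rfl
    intro x _
    rw [Real.dist_eq, sq_abs]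
  · intro x hx
    apply hF
    intro h
    apply hx
    simp [h]

theorem euclid_triangle (φ ψ χ : X) : euclid φ.1 χ.1 ≤ euclid φ.1 ψ.1 + euclid ψ.1 χ.1 := by
  classical
  let F : Finset V := (finite_ne φ χ).toFinset ∪ ((finite_ne φ ψ).toFinset ∪
    (finite_ne ψ χ).toFinset)
  rw [euclid_eq φ χ F, euclid_eq φ ψ F, euclid_eq ψ χ F]
  · exact dist_triangle _ _ _
  all_goals
    intro x hx
    simp [F, hx]

theorem euclid_self (φ : X) : euclid φ.1 φ.1 = 0 := by
  simp [euclid]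

theorem euclid_le_sum (p : ℕ → X) (m : ℕ) :
    euclid (p 0).1 (p m).1 ≤ ∑ i ∈ Finset.range m, euclid (p i).1 (p (i + 1)).1 := by
  induction m with
  | zero => simp [euclid_self]
  | succ m ih =>
    rw [Finset.sum_range_succ]
    exact (euclid_triangle _ (p m) _).trans (by linarith)

theorem isLeast_euclid (φ ψ : X) : IsLeast (stringLengths φ ψ) (euclid φ.1 ψ.1) := by
  constructor
  · refine ⟨1, fun i => if i = 0 then φ else ψ, rfl, rfl, ?_, ?_⟩
    · intro i _
      exact inCommonCube _ _
    · simp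
  · rintro L ⟨m, p, rfl, rfl, -, rfl⟩
    exact euclid_le_sum p m

/-- The metric of the cube complex: the distance of two points is the infimum of the lengths of the
strings between them. The topology of `X` is the one of this metric. -/
noncomputable instance : MetricSpace X where
  dist φ ψ := sInf (stringLengths φ ψ)
  dist_self φ := by rw [(isLeast_euclid φ φ).csInf_eq, euclid_self]
  dist_comm φ ψ := by
    rw [(isLeast_euclid φ ψ).csInf_eq, (isLeast_euclid ψ φ).csInf_eq, euclid, euclid]
    congr 2
    funext x
    ring
  dist_triangle φ ψ χ := by
    rw [(isLeast_euclid φ ψ).csInf_eq, (isLeast_euclid ψ χ).csInf_eq,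
      (isLeast_euclid φ χ).csInf_eq]
    exact euclid_triangle φ ψ χ
  eq_of_dist_eq_zero {φ ψ} h := by
    rw [(isLeast_euclid φ ψ).csInf_eq,
      euclid_eq φ ψ (finite_ne φ ψ).toFinset (fun x hx => by simpa using hx), dist_eq_zero] at h
    apply Subtype.ext
    funext x
    by_contra hc
    have h' := congrArg (fun f : EuclideanSpace ℝ (finite_ne φ ψ).toFinset =>
      f ⟨x, by simpa using hc⟩) h
    exact hc h'

theorem dist_eq_euclid (φ ψ : X) : dist φ ψ = euclid φ.1 ψ.1 := (isLeast_euclid φ ψ).csInf_eq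

/-! ## The action of `G_ω` on `X` -/

theorem gens_leave {ω : ℕ → Fin 3} {s : G ω} (hs : s.1 ∈ gens ω) {x : V} (hx : x ∈ ΓPlus)
    (h0 : x ≠ zeroSeq) : s • x ∈ ΓPlus := by
  rcases smul_adj_or_eq hs x with h | h
  · rwa [h]
  · by_cases h1 : s • x = zeroSeq
    · exact Or.inl h1
    · right
      rcases hx with hx | ⟨p, hp⟩
      · exact absurd hx h0
      · refine ⟨p.concat h, ?_⟩
        rw [SimpleGraph.Walk.support_concat]
        simp only [List.mem_append, List.mem_singleton, not_or]
        exact ⟨hp, fun e => h1 e.symm⟩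

theorem gens_commensurate {ω : ℕ → Fin 3} {s : G ω} (hs : s.1 ∈ gens ω) :
    {x | ¬ (s • x ∈ ΓPlus ↔ x ∈ ΓPlus)}.Finite := by
  have hss : ∀ x : V, s • s • x = x := fun x => Subtype.ext (gens_smul_smul hs x.1)
  apply ((Set.finite_singleton zeroSeq).union (Set.finite_singleton (s • zeroSeq))).subset
  intro x hx
  by_contra hc
  simp only [Set.mem_union, Set.mem_singleton_iff, not_or] at hc
  apply hx
  constructor
  · intro h
    have := gens_leave hs h (fun e => hc.2 (by rw [← e, hss]))
    rwa [hss] at this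
  · intro h
    exact gens_leave hs h hc.1

/-- The set `Γ₊` is commensurated by `G_ω`. -/
theorem commensurate {ω : ℕ → Fin 3} (g : G ω) :
    {x | ¬ (g • x ∈ ΓPlus ↔ x ∈ ΓPlus)}.Finite := by
  obtain ⟨g, hg⟩ := g
  refine Subgroup.closure_induction'' (p := fun g hg =>
    {x : V | ¬ ((⟨g, hg⟩ : G ω) • x ∈ ΓPlus ↔ x ∈ ΓPlus)}.Finite) ?_ ?_ ?_ ?_ hg
  · intro s hs
    exact gens_commensurate (s := ⟨s, Subgroup.subset_closure hs⟩) hs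
  · intro s hs
    have h1 : s⁻¹ = s := inv_eq_of_mul_eq_one_left (gens_mul_self hs)
    have h2 : s⁻¹ ∈ gens ω := by rwa [h1]
    exact gens_commensurate (s := ⟨s⁻¹, Subgroup.subset_closure h2⟩) h2
  · apply Set.finite_empty.subset
    intro x hx
    apply hx
    have : (⟨1, Subgroup.one_mem _⟩ : G ω) • x = x := one_smul (G ω) x
    rw [this]
  · intro g h hg hh ihg ihh
    have e : ∀ x : V, (⟨g * h, Subgroup.mul_mem _ hg hh⟩ : G ω) • x =
        (⟨g, hg⟩ : G ω) • (⟨h, hh⟩ : G ω) • x := fun x => mul_smul (⟨g, hg⟩ : G ω) ⟨h, hh⟩ x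
    apply (ihh.union (ihg.preimage (f := fun x : V => (⟨h, hh⟩ : G ω) • x)
      (MulAction.injective _).injOn)).subset
    intro x hx
    by_contra hc
    simp only [Set.mem_union, Set.mem_ofPred_eq, Set.mem_preimage, not_or, not_not] at hc
    apply hx
    rw [e]
    exact hc.2.trans hc.1

/-- The action of `G_ω` on `X`: `(g φ)(x) = φ (g⁻¹ x)`. On the vertices of `X` this is the action of
`G_ω` on colorings, and it maps cubes to cubes. -/
instance (ω : ℕ → Fin 3) : MulAction (G ω) X where
  smul g φ := ⟨fun x => φ.1 (g⁻¹ • x), by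
    have h := (mem_X_iff _).1 φ.2
    rw [mem_X_iff]
    refine ⟨fun x => h.1 _, ?_⟩
    apply ((h.2.preimage (f := fun x : V => g⁻¹ • x) (MulAction.injective _).injOn).union
      (commensurate g⁻¹)).subset
    intro x hx
    by_contra hc
    simp only [Set.mem_union, Set.mem_ofPred_eq, Set.mem_preimage, not_or, not_not] at hc
    apply hx
    show φ.1 (g⁻¹ • x) = _
    rw [hc.1]
    by_cases hxv : x ∈ ΓPlus
    · simp [hxv, hc.2.2 hxv]
    · have : g⁻¹ • x ∉ ΓPlus := fun h' => hxv (hc.2.1 h')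
      simp [hxv, this]⟩
  one_smul φ := Subtype.ext (funext fun x => by
    show φ.1 ((1 : G ω)⁻¹ • x) = φ.1 x
    rw [inv_one, one_smul])
  mul_smul g h φ := Subtype.ext (funext fun x => by
    show φ.1 ((g * h)⁻¹ • x) = φ.1 (h⁻¹ • g⁻¹ • x)
    rw [mul_inv_rev, mul_smul])

/-! ## Proper actions and their classifying spaces -/

/-- A proper action of a discrete group `H` on a topological space `Z`: the group acts by
homeomorphisms, and every point has an open `H`-invariant neighbourhood `U` with a continuous
`H`-equivariant map to the discrete space `H ⧸ K` for some finite subgroup `K`. -/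
structure IsProperAction (H : Type*) [Group H] (Z : Type*) [TopologicalSpace Z]
    [MulAction H Z] : Prop where
  continuous_smul : ∀ h : H, Continuous fun z : Z => h • z
  slice : ∀ z : Z, ∃ U : Set Z, IsOpen U ∧ z ∈ U ∧ (∀ (h : H), ∀ u ∈ U, h • u ∈ U) ∧
    ∃ K : Subgroup H, (K : Set H).Finite ∧ ∃ ρ : U → H ⧸ K, IsLocallyConstant ρ ∧
      ∀ (h : H) (u : U) (hu : h • u.1 ∈ U), ρ ⟨h • u.1, hu⟩ = h • ρ u

/-- `E` is a model for the classifying space of proper actions of the discrete group `H`. It is a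
proper `H`-space in the sense of Baum, Connes and Higson (the action is proper, and `E` and `H\E`
are metrizable), and it is universal: every space `Z` with a proper `H`-action has an `H`-equivariant
continuous map to `E`, and any two such maps are homotopic through `H`-equivariant maps. The
universality is asked for all `Z` whose quotient `H\Z` is paracompact Hausdorff, in particular for
all `Z` such that `Z` and `H\Z` are metrizable. -/
structure IsModelEUnderline (H : Type v) [Group H] (E : Type w) [TopologicalSpace E]
    [MulAction H E] : Prop where
  proper : IsProperAction H E
  metrizable : TopologicalSpace.MetrizableSpace E
  metrizable_quotient : TopologicalSpace.MetrizableSpace (Quotient (MulAction.orbitRel H E))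
  exists_map : ∀ (Z : Type u) [TopologicalSpace Z] [MulAction H Z], IsProperAction H Z →
    T2Space (Quotient (MulAction.orbitRel H Z)) →
    ParacompactSpace (Quotient (MulAction.orbitRel H Z)) →
    ∃ f : C(Z, E), ∀ (h : H) (z : Z), f (h • z) = h • f z
  homotopic : ∀ (Z : Type u) [TopologicalSpace Z] [MulAction H Z], IsProperAction H Z →
    T2Space (Quotient (MulAction.orbitRel H Z)) →
    ParacompactSpace (Quotient (MulAction.orbitRel H Z)) →
    ∀ f₀ f₁ : C(Z, E), (∀ (h : H) (z : Z), f₀ (h • z) = h • f₀ z) →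
      (∀ (h : H) (z : Z), f₁ (h • z) = h • f₁ z) →
      ∃ F : f₀.Homotopy f₁, ∀ (t : unitInterval) (h : H) (z : Z), F (t, h • z) = h • F (t, z)

end GrigorchukCube

namespace GrigorchukCube

/-! ## The linear embedding of `X` -/

/-! Subtracting the indicator of `ΓPlus` embeds the complex isometrically as a convex subset of
`ℓ²(V)`, and the group acts on it by affine isometries. Universality follows from convexity. A
finite subgroup fixes the barycentre of an orbit, so every slice carries an equivariant map to `X`.
These local maps are glued with a partition of unity pulled back from the orbit space, and two
equivariant maps are joined by the straight-line homotopy.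

For properness and metrizability, each point takes finitely many values as a function on `V`. The
nonzero coordinate differences between `φ` and all translates of `ψ` are therefore bounded below,
and orbits are uniformly separated. What remains is finiteness of point stabilizers
(`finite_stabilizer`), the only place where the absence of repetition in `ω` enters.

By `mem_ΓPlus_iff`, with positions counted from 0, `ΓPlus` consists of `0^∞` and the sequences whose
last letter `1` is at an even position. Deleting the first letter reverses that parity, so
half-lines are self-similar: sections of an element preserving a set that is eventually a half-line
preserve sets that are half-lines one level sooner (`finite_pres_of_agree`). This reduces the claim
to the stabilizers of `ΓPlus ∖ {0^∞}` and of `ΓPlus`, which lie in the finite sets `V4 ω` and `Dih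
ω`.

Those two inclusions are proved together by induction on word length
(`mem_V4_and_mem_Dih_of_words`). An element preserving `ΓPlus ∖ {0^∞}` fixes the first level, since
otherwise a section would map `ΓPlus` onto itself minus a point; this is excluded by the flow, a
homomorphism to `ℤ` that vanishes because the generators are involutions. Its sections at `0` and
`1` preserve `ΓPlus` and `ΓPlus ∖ {0^∞}` respectively. The induction hypothesis leaves finitely many
pairs of sections, and `SectionRelation`, an identity in a dihedral group of order eight, discards
those that do not come from the claimed stabilizer. -/

theorem X.mem_Icc (φ : X) (x : V) : φ.1 x ∈ Set.Icc (0 : ℝ) 1 := ((mem_X_iff _).1 φ.2).1 x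

theorem X.finite_ne_indicator (φ : X) : {x | φ.1 x ≠ ΓPlus.indicator 1 x}.Finite :=
  ((mem_X_iff _).1 φ.2).2

theorem smul_apply_X {ω : ℕ → Fin 3} (g : G ω) (φ : X) (x : V) : (g • φ).1 x = φ.1 (g⁻¹ • x) := rfl

/-- The Hilbert space of square summable functions on the vertices of `Γ`. -/
abbrev L2V : Type := lp (fun _ : V => ℝ) 2

/-- The affine embedding of `X` into a Hilbert space, taking the indicator of `Γ₊` as origin. -/
noncomputable def toL2 (φ : X) : L2V :=
  ⟨fun x => φ.1 x - ΓPlus.indicator 1 x, by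
    apply memℓp_gen
    apply summable_of_hasFiniteSupport
    apply φ.finite_ne_indicator.subset
    intro x hx h
    apply hx
    simp [h]⟩

theorem toL2_apply (φ : X) (x : V) : toL2 φ x = φ.1 x - ΓPlus.indicator 1 x := rfl

/-- The subtracted origin cancels in differences, and two points of `X` differ at only finitely many
places, so the `ℓ²` sum is the finite sum defining `euclid`. -/
theorem isometry_toL2 : Isometry toL2 := by
  refine Isometry.of_dist_eq fun φ ψ => ?_
  rw [dist_eq_euclid, dist_eq_norm, lp.norm_eq_tsum_rpow (by norm_num), euclid, Real.sqrt_eq_rpow]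
  have h : ∀ x, ‖(toL2 φ - toL2 ψ) x‖ ^ (2 : ENNReal).toReal = (φ.1 x - ψ.1 x) ^ 2 := by
    intro x
    rw [lp.coeFn_sub, Pi.sub_apply, toL2_apply, toL2_apply, sub_sub_sub_cancel_right]
    simp
  simp only [h]
  rw [tsum_eq_finsum]
  · simp
  · apply (finite_ne φ ψ).subset
    intro x hx h
    apply hx
    simp [h]

theorem mem_range_toL2 (ξ : L2V) : ξ ∈ Set.range toL2 ↔
    (∀ x, ξ x + ΓPlus.indicator 1 x ∈ Set.Icc (0 : ℝ) 1) ∧ {x | ξ x ≠ 0}.Finite := by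
  constructor
  · rintro ⟨φ, rfl⟩
    refine ⟨fun x => by simpa only [toL2_apply, sub_add_cancel] using φ.mem_Icc x, ?_⟩
    simpa [toL2_apply, sub_ne_zero] using φ.finite_ne_indicator
  · rintro ⟨h1, h2⟩
    refine ⟨⟨fun x => ξ x + ΓPlus.indicator 1 x, (mem_X_iff _).2 ⟨h1, by simpa using h2⟩⟩, ?_⟩
    ext x
    exact add_sub_cancel_right _ _

theorem convex_range_toL2 : Convex ℝ (Set.range toL2) := by
  intro ξ hξ η hη s t hs ht hst
  rw [mem_range_toL2] at *
  refine ⟨fun x => ?_, (hξ.2.union hη.2).subset ?_⟩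
  · have h := convex_Icc (0 : ℝ) 1 (hξ.1 x) (hη.1 x) hs ht hst
    convert h using 1
    simp only [lp.coeFn_add, lp.coeFn_smul, Pi.add_apply, Pi.smul_apply, smul_eq_mul]
    linear_combination (ΓPlus.indicator 1 x : ℝ) * (-hst)
  · intro x hx
    by_contra hc
    simp only [Set.mem_union, Set.mem_ofPred_eq, not_or, not_not] at hc
    apply hx
    simp only [lp.coeFn_add, lp.coeFn_smul, Pi.add_apply, Pi.smul_apply, hc.1, hc.2, smul_zero,
      add_zero]

theorem toL2_smul_apply {ω : ℕ → Fin 3} (g : G ω) (φ : X) (x : V) :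
    toL2 (g • φ) x = toL2 φ (g⁻¹ • x) + (ΓPlus.indicator 1 (g⁻¹ • x) - ΓPlus.indicator 1 x) := by
  rw [toL2_apply, toL2_apply, smul_apply_X]
  ring

/-- In the linear picture `g` acts by a permutation of coordinates plus a translation that does not
depend on the point. Weights of sum one reproduce the translation, so the action commutes with
affine combinations. -/
theorem toL2_smul_sum {ω : ℕ → Fin 3} {ι : Type*} (s : Finset ι) (c : ι → ℝ)
    (hc : ∑ i ∈ s, c i = 1) (ψ : ι → X) (φ : X) (hφ : toL2 φ = ∑ i ∈ s, c i • toL2 (ψ i))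
    (g : G ω) : toL2 (g • φ) = ∑ i ∈ s, c i • toL2 (g • ψ i) := by
  ext x
  rw [toL2_smul_apply, hφ]
  simp only [lp.coeFn_sum, Finset.sum_apply, lp.coeFn_smul, Pi.smul_apply, smul_eq_mul,
    toL2_smul_apply, mul_add, Finset.sum_add_distrib, ← Finset.sum_mul, hc, one_mul]

theorem exists_continuousMap_toL2 {Z : Type*} [TopologicalSpace Z] {f : Z → L2V}
    (hf : Continuous f) (hr : ∀ z, f z ∈ Set.range toL2) : ∃ F : C(Z, X), ∀ z, toL2 (F z) = f z := by
  choose F hF using hr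
  refine ⟨⟨F, isometry_toL2.isEmbedding.continuous_iff.2 ?_⟩, hF⟩
  convert hf using 1
  exact funext hF

/-- The point of `X` that is the vertex `Γ₊`. -/
noncomputable def basePoint : X :=
  ⟨ΓPlus.indicator 1, (mem_X_iff _).2 ⟨fun x => by by_cases h : x ∈ ΓPlus <;> simp [h], by simp⟩⟩

/-- A finite subgroup of `G_ω` has a fixed point in `X`. -/
theorem exists_fixedPoint {ω : ℕ → Fin 3} (K : Subgroup (G ω)) (hK : (K : Set (G ω)).Finite) :
    ∃ φ : X, ∀ k ∈ K, k • φ = φ := by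
  have : Finite K := hK
  have := Fintype.ofFinite K
  have hc : ∑ _k : K, (Fintype.card K : ℝ)⁻¹ = 1 := by simp
  obtain ⟨φ, hφ⟩ : ∑ k : K, (Fintype.card K : ℝ)⁻¹ • toL2 (k.1 • basePoint) ∈ Set.range toL2 :=
    convex_range_toL2.sum_mem (fun _ _ => by positivity) hc (fun k _ => ⟨_, rfl⟩)
  refine ⟨φ, fun k hk => isometry_toL2.injective ?_⟩
  rw [toL2_smul_sum Finset.univ (fun _ => (Fintype.card K : ℝ)⁻¹) hc
    (fun k : K => k.1 • basePoint) φ hφ k, hφ]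
  refine Fintype.sum_equiv (Equiv.mulLeft ⟨k, hk⟩) _ _ fun l => ?_
  rw [smul_smul]
  rfl

/-! ## Equivariant maps to `X` -/

/-- Over a slice there is a locally constant equivariant map to `X`. -/
theorem exists_local_equivariant {ω : ℕ → Fin 3} {Z : Type*} [TopologicalSpace Z]
    [MulAction (G ω) Z] (hZ : IsProperAction (G ω) Z) (z : Z) :
    ∃ U : Set Z, IsOpen U ∧ z ∈ U ∧ (∀ (h : G ω), ∀ u ∈ U, h • u ∈ U) ∧
      ∃ f : Z → X, ContinuousOn f U ∧ ∀ (h : G ω), ∀ u ∈ U, f (h • u) = h • f u := by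
  classical
  obtain ⟨U, hU, hz, hinv, K, hK, ρ, hρ, heq⟩ := hZ.slice z
  obtain ⟨φ, hφ⟩ := exists_fixedPoint K hK
  -- Moving the fixed point by a representative of a coset of `K` does not depend on the
  -- representative, so the choice made by `Quotient.out` is equivariant on `φ`.
  have key : ∀ (h : G ω) (q : G ω ⧸ K), (h • q).out • φ = h • q.out • φ := by
    intro h q
    have e : (h • q) = ((h * q.out : G ω) : G ω ⧸ K) := by
      conv_lhs => rw [← q.out_eq']
      rfl
    obtain ⟨k, hk⟩ := QuotientGroup.mk_out_eq_mul K (h * q.out)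
    rw [e, hk, mul_smul, hφ _ k.2, mul_smul]
  refine ⟨U, hU, hz, hinv, fun z => if hz : z ∈ U then (ρ ⟨z, hz⟩).out • φ else basePoint, ?_, ?_⟩
  · rw [continuousOn_iff_continuous_domRestrict]
    have := (hρ.comp fun q => q.out • φ).continuous
    convert this using 1
    funext u
    simp
  · intro h u hu
    simp only [hu, hinv h u hu, dite_true]
    rw [heq h ⟨u, hu⟩ (hinv h u hu), key]

/-- The pullback of a partition of unity under a continuous map. -/
def partitionOfUnityComap {ι Y Z : Type*} [TopologicalSpace Y] [TopologicalSpace Z]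
    (ρ : PartitionOfUnity ι Y) (π : C(Z, Y)) : PartitionOfUnity ι Z where
  toFun i := (ρ i).comp π
  locallyFinite' := ρ.locallyFinite.preimage_continuous π.continuous
  nonneg' i z := ρ.nonneg i (π z)
  sum_eq_one' z _ := ρ.sum_eq_one (Set.mem_univ (π z))
  sum_le_one' z := ρ.sum_le_one (π z)

/-- The weights come from the orbit space and are therefore invariant. Local equivariant maps
averaged with them stay in `X` by convexity and stay equivariant because the action is affine. -/
theorem exists_equivariant_map {ω : ℕ → Fin 3} {Z : Type*} [TopologicalSpace Z]
    [MulAction (G ω) Z] (hZ : IsProperAction (G ω) Z)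
    [T2Space (Quotient (MulAction.orbitRel (G ω) Z))]
    [ParacompactSpace (Quotient (MulAction.orbitRel (G ω) Z))] :
    ∃ f : C(Z, X), ∀ (h : G ω) (z : Z), f (h • z) = h • f z := by
  have : ContinuousConstSMul (G ω) Z := ⟨hZ.continuous_smul⟩
  choose U hU hzU hinv f hf heq using exists_local_equivariant hZ
  let π : C(Z, Quotient (MulAction.orbitRel (G ω) Z)) := ⟨Quotient.mk _, continuous_quotient_mk'⟩
  have hπ : ∀ (h : G ω) (z : Z), π (h • z) = π z := fun h z => Quotient.sound ⟨h, rfl⟩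
  -- Each slice is invariant, hence saturated: membership can be tested in the orbit space.
  have hπU : ∀ i z, π z ∈ π '' U i → z ∈ U i := by
    rintro i z ⟨y, hy, e⟩
    obtain ⟨h, rfl⟩ := Quotient.exact e
    have := hinv i h⁻¹ _ hy
    rwa [inv_smul_smul] at this
  obtain ⟨ρ, hρ⟩ := PartitionOfUnity.exists_isSubordinate isClosed_univ (fun i => π '' U i)
    (fun i => isOpenMap_quotient_mk'_mul _ (hU i)) (by
      intro q _
      induction q using Quotient.inductionOn with
      | h z => exact Set.mem_iUnion.2 ⟨z, z, hzU z, rfl⟩)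
  have hρU : ∀ i z, ρ i (π z) ≠ 0 → z ∈ U i := fun i z h =>
    hπU i z (hρ i (subset_tsupport _ h))
  let ρ' := partitionOfUnityComap ρ π
  -- Each `f i` is continuous only on `U i`; this suffices because the closed support of its weight
  -- lies in `U i`.
  have hcont : Continuous fun z => ∑ᶠ i, ρ' i z • toL2 (f i z) := by
    apply ρ'.continuous_finsum_smul
    intro i z hz
    have hzU : z ∈ U i := hπU i z (hρ i (tsupport_comp_subset_preimage (ρ i) π.continuous hz))
    exact isometry_toL2.continuous.continuousAt.comp ((hf i).continuousAt ((hU i).mem_nhds hzU))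
  obtain ⟨F, hF⟩ := exists_continuousMap_toL2 hcont fun z =>
    ρ'.finsum_smul_mem_convex (g := fun i z => toL2 (f i z)) (Set.mem_univ z) (fun i _ => ⟨_, rfl⟩)
      convex_range_toL2
  refine ⟨F, fun h z => isometry_toL2.injective ?_⟩
  have hF' : ∀ z, toL2 (F z) = ∑ i ∈ ρ'.finsupport z, ρ' i z • toL2 (f i z) := fun z => by
    rw [hF, ρ'.sum_finsupport_smul_eq_finsum (φ := fun i z => toL2 (f i z))]
  rw [toL2_smul_sum _ _ (ρ'.sum_finsupport (Set.mem_univ z)) _ _ (hF' z) h, hF']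
  have hval : ∀ i, ρ' i (h • z) = ρ' i z := fun i => congrArg (ρ i) (hπ h z)
  have hsupp : ρ'.finsupport (h • z) = ρ'.finsupport z := by
    ext i
    rw [ρ'.mem_finsupport, ρ'.mem_finsupport, Function.mem_support, Function.mem_support, hval]
  rw [hsupp]
  refine Finset.sum_congr rfl fun i hi => ?_
  rw [ρ'.mem_finsupport] at hi
  rw [hval, heq i h z (hρU i z hi)]

/-- The straight line between the two maps stays in the convex image of `X`, and affine maps carry
segments to segments. -/
theorem exists_equivariant_homotopy {ω : ℕ → Fin 3} {Z : Type*} [TopologicalSpace Z]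
    [MulAction (G ω) Z] (f₀ f₁ : C(Z, X)) (h₀ : ∀ (h : G ω) (z : Z), f₀ (h • z) = h • f₀ z)
    (h₁ : ∀ (h : G ω) (z : Z), f₁ (h • z) = h • f₁ z) :
    ∃ F : f₀.Homotopy f₁, ∀ (t : unitInterval) (h : G ω) (z : Z), F (t, h • z) = h • F (t, z) := by
  obtain ⟨F, hF⟩ := exists_continuousMap_toL2 (Z := unitInterval × Z)
    (f := fun p => (1 - p.1 : ℝ) • toL2 (f₀ p.2) + (p.1 : ℝ) • toL2 (f₁ p.2))
    (by
      have := isometry_toL2.continuous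
      fun_prop)
    (fun p => convex_range_toL2 ⟨_, rfl⟩ ⟨_, rfl⟩ (by linarith [p.1.2.2]) p.1.2.1 (by ring))
  refine ⟨⟨F, fun z => isometry_toL2.injective ?_, fun z => isometry_toL2.injective ?_⟩, ?_⟩
  · erw [hF]; simp
  · erw [hF]; simp
  · intro t h z
    apply isometry_toL2.injective
    change toL2 (F _) = toL2 (h • F _)
    have := toL2_smul_sum (Finset.univ : Finset (Fin 2)) ![(1 - t : ℝ), (t : ℝ)] (by simp)
      ![f₀ z, f₁ z] (F (t, z)) (by rw [hF]; simp) h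
    rw [this, hF]
    simp [h₀, h₁]

/-! ## Quotients of metric spaces by isometric actions with separated orbits -/

section Quotient

variable {H E : Type*} [Group H] [MetricSpace E] [MulAction H E]

theorem infDist_orbit_eq (hiso : ∀ (h : H) (x y : E), dist (h • x) (h • y) = dist x y)
    (g h : H) (x y : E) :
    Metric.infDist (g • x) (MulAction.orbit H (h • y)) = Metric.infDist x (MulAction.orbit H y) := by
  rw [MulAction.orbit_smul]
  have key : ∀ (g : H) (x : E), Metric.infDist (g • x) (MulAction.orbit H y) ≤
      Metric.infDist x (MulAction.orbit H y) := by
    intro g x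
    rw [Metric.le_infDist (MulAction.nonempty_orbit y)]
    rintro z hz
    rw [← hiso g]
    exact Metric.infDist_le_dist_of_mem ((MulAction.mem_orbit_iff.2 ⟨g, rfl⟩ :
      g • z ∈ MulAction.orbit H z) |> fun h => MulAction.orbit_eq_iff.2 hz ▸ h)
  apply le_antisymm (key g x)
  simpa using key g⁻¹ (g • x)

theorem infDist_orbit_comm (hiso : ∀ (h : H) (x y : E), dist (h • x) (h • y) = dist x y)
    (x y : E) :
    Metric.infDist x (MulAction.orbit H y) = Metric.infDist y (MulAction.orbit H x) := by
  have key : ∀ x y : E, Metric.infDist x (MulAction.orbit H y) ≤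
      Metric.infDist y (MulAction.orbit H x) := by
    intro x y
    rw [Metric.le_infDist (MulAction.nonempty_orbit x)]
    rintro _ ⟨g, rfl⟩
    change _ ≤ dist y (g • x)
    rw [← infDist_orbit_eq hiso g 1 x y, one_smul, dist_comm]
    exact Metric.infDist_le_dist_of_mem (MulAction.mem_orbit_self y)
  exact le_antisymm (key x y) (key y x)

/-- The orbit space of an isometric action is metrizable if distinct orbits have positive distance. -/
theorem metrizableSpace_quotient_of_isometric
    (hiso : ∀ (h : H) (x y : E), dist (h • x) (h • y) = dist x y)
    (hsep : ∀ x y : E, ∃ ε > 0, ∀ h : H, dist x (h • y) < ε → x = h • y) :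
    TopologicalSpace.MetrizableSpace (Quotient (MulAction.orbitRel H E)) := by
  let d : Quotient (MulAction.orbitRel H E) → Quotient (MulAction.orbitRel H E) → ℝ :=
    Quotient.lift₂ (fun x y => Metric.infDist x (MulAction.orbit H y)) (by
      rintro _ _ x y ⟨g, rfl⟩ ⟨h, rfl⟩
      exact infDist_orbit_eq hiso g h x y)
  have hd : ∀ x y : E, d ⟦x⟧ ⟦y⟧ = Metric.infDist x (MulAction.orbit H y) := fun _ _ => rfl
  have hlt : ∀ (x y : E) (r : ℝ), d ⟦x⟧ ⟦y⟧ < r ↔ ∃ h : H, dist x (h • y) < r := by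
    intro x y r
    rw [hd, Metric.infDist_lt_iff (MulAction.nonempty_orbit y)]
    constructor
    · rintro ⟨_, ⟨h, rfl⟩, hr⟩
      exact ⟨h, hr⟩
    · rintro ⟨h, hr⟩
      exact ⟨_, ⟨h, rfl⟩, hr⟩
  let m : MetricSpace (Quotient (MulAction.orbitRel H E)) :=
    { dist := d
      dist_self := by
        rintro ⟨x⟩
        exact Metric.infDist_zero_of_mem (MulAction.mem_orbit_self x)
      dist_comm := by
        rintro ⟨x⟩ ⟨y⟩
        exact infDist_orbit_comm hiso x y
      dist_triangle := by
        rintro ⟨x⟩ ⟨y⟩ ⟨z⟩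
        apply le_of_forall_pos_lt_add
        intro ε hε
        obtain ⟨g, hg⟩ := (hlt x y _).1 (lt_add_of_pos_right _ (half_pos hε))
        obtain ⟨h, hh⟩ := (hlt y z _).1 (lt_add_of_pos_right _ (half_pos hε))
        refine (hlt x z _).2 ⟨g * h, ?_⟩
        have h1 := dist_triangle x (g • y) ((g * h) • z)
        rw [mul_smul, hiso] at h1
        rw [mul_smul]
        change _ < d ⟦x⟧ ⟦y⟧ + d ⟦y⟧ ⟦z⟧ + ε
        linarith
      eq_of_dist_eq_zero := by
        rintro ⟨x⟩ ⟨y⟩ h0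
        obtain ⟨ε, hε, hs⟩ := hsep x y
        obtain ⟨h, hh⟩ := (hlt x y ε).1 (h0.trans_lt hε)
        exact Quotient.sound ⟨h, (hs h hh).symm⟩ }
  suffices h : m.toUniformSpace.toTopologicalSpace = instTopologicalSpaceQuotient from
    h ▸ inferInstance
  ext U
  rw [isOpen_coinduced]
  constructor
  · intro hU
    refine Metric.isOpen_iff.2 fun x hx => ?_
    obtain ⟨ε, hε, hs⟩ := (@Metric.isOpen_iff _ m.toPseudoMetricSpace U).1 hU ⟦x⟧ hx
    refine ⟨ε, hε, fun y hy => hs ((hlt y x ε).2 ⟨1, ?_⟩)⟩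
    rwa [one_smul]
  · intro hU
    refine (@Metric.isOpen_iff _ m.toPseudoMetricSpace U).2 ?_
    rintro ⟨x⟩ hx
    obtain ⟨ε, hε, hs⟩ := Metric.isOpen_iff.1 hU x hx
    refine ⟨ε, hε, ?_⟩
    rintro ⟨y⟩ hy
    have hy' : d ⟦x⟧ ⟦y⟧ < ε := by
      have := @dist_comm _ m.toPseudoMetricSpace ⟦x⟧ ⟦y⟧
      exact this.trans_lt hy
    obtain ⟨h, hh⟩ := (hlt x y ε).1 hy'
    have h1 : h • y ∈ Metric.ball x ε := by rwa [Metric.mem_ball, dist_comm]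
    have h2 : (⟦h • y⟧ : Quotient (MulAction.orbitRel H E)) ∈ U := hs h1
    rwa [show (⟦h • y⟧ : Quotient (MulAction.orbitRel H E)) = ⟦y⟧ from Quotient.sound ⟨h, rfl⟩] at h2

/-- An isometric action with finite stabilizers and uniformly discrete orbits is proper. -/
theorem isProperAction_of_isometric
    (hiso : ∀ (h : H) (x y : E), dist (h • x) (h • y) = dist x y)
    (hsep : ∀ x y : E, ∃ ε > 0, ∀ h : H, dist x (h • y) < ε → x = h • y)
    (hfin : ∀ x : E, {h : H | h • x = x}.Finite) : IsProperAction H E where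
  continuous_smul h := (Isometry.of_dist_eq (hiso h)).continuous
  slice x := by
    obtain ⟨ε, hε, hs⟩ := hsep x x
    -- Half the separation constant is used so that a point in two of these balls forces their
    -- centres to coincide; each ball then determines a coset of the stabilizer.
    let U : Set E := ⋃ h : H, Metric.ball (h • x) (ε / 2)
    have hU : ∀ u : U, ∃ h : H, u.1 ∈ Metric.ball (h • x) (ε / 2) := fun u =>
      Set.mem_iUnion.1 (show u.1 ∈ ⋃ h : H, Metric.ball (h • x) (ε / 2) from u.2)
    choose c hc using hU
    have huniq : ∀ (g h : H) (y : E), dist y (g • x) < ε / 2 → dist y (h • x) < ε / 2 →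
        (g : H ⧸ MulAction.stabilizer H x) = h := by
      intro g h y hg hh
      rw [QuotientGroup.eq, MulAction.mem_stabilizer_iff]
      refine (hs _ ?_).symm
      rw [← hiso g, mul_smul, smul_inv_smul]
      have := dist_triangle_left (g • x) (h • x) y
      linarith
    refine ⟨U, isOpen_iUnion fun h => Metric.isOpen_ball,
      Set.mem_iUnion.2 ⟨1, by simpa using hε⟩, ?_, MulAction.stabilizer H x, hfin x,
      fun u => c u, ?_, ?_⟩
    · rintro h u hu
      obtain ⟨g, hg⟩ := Set.mem_iUnion.1 hu
      refine Set.mem_iUnion.2 ⟨h * g, ?_⟩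
      rw [Metric.mem_ball, mul_smul, hiso]
      exact hg
    · rw [IsLocallyConstant.iff_exists_open]
      intro u
      refine ⟨{y : U | dist y.1 (c u • x) < ε / 2}, ?_, hc u, ?_⟩
      · exact Metric.isOpen_ball.preimage continuous_subtype_val
      · intro y hy
        exact huniq _ _ y.1 (hc y) hy
    · intro h u hu
      refine huniq (c ⟨h • u.1, hu⟩) (h * c u) (h • u.1) (hc ⟨h • u.1, hu⟩) ?_
      rw [mul_smul, hiso]
      exact hc u

end Quotient

/-! ## The metric properties of the action on `X` -/

theorem dist_smul_smul {ω : ℕ → Fin 3} (g : G ω) (φ ψ : X) : dist (g • φ) (g • ψ) = dist φ ψ := by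
  rw [dist_eq_euclid, dist_eq_euclid, euclid, euclid]
  congr 1
  exact finsum_comp_equiv (MulAction.toPerm g⁻¹ : Equiv.Perm V)
    (f := fun x => (φ.1 x - ψ.1 x) ^ 2)

theorem abs_sub_le_dist (φ ψ : X) (x : V) : |φ.1 x - ψ.1 x| ≤ dist φ ψ := by
  have h := lp.norm_apply_le_norm (p := 2) (by norm_num) (toL2 φ - toL2 ψ) x
  rw [← dist_eq_norm, isometry_toL2.dist_eq] at h
  simpa [toL2_apply] using h

theorem X.finite_range (φ : X) : (Set.range φ.1).Finite := by
  apply ((φ.finite_ne_indicator.image φ.1).union (Set.toFinite {0, 1})).subset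
  rintro _ ⟨x, rfl⟩
  by_cases h : φ.1 x = ΓPlus.indicator 1 x
  · right
    rw [h]
    by_cases hx : x ∈ ΓPlus <;> simp [hx]
  · exact Or.inl ⟨x, h, rfl⟩

/-- Translating `ψ` does not change its set of values, so finitely many numbers `|φ x - (g • ψ) x|`
occur over all `g` and `x`. A distance below the least nonzero one makes every coordinate agree. -/
theorem exists_pos_separation (ω : ℕ → Fin 3) (φ ψ : X) :
    ∃ ε > 0, ∀ g : G ω, dist φ (g • ψ) < ε → φ = g • ψ := by
  let D : Set ℝ := Set.image2 (fun a b => |a - b|) (Set.range φ.1) (Set.range ψ.1)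
  have hD : (D \ {0}).Finite := (Set.Finite.image2 _ φ.finite_range ψ.finite_range).sdiff
  have hex : ∃ ε > 0, ∀ a ∈ D \ {0}, ε ≤ a := by
    rcases (D \ {0}).eq_empty_or_nonempty with h | h
    · exact ⟨1, one_pos, by simp [h]⟩
    · obtain ⟨a, ha, hmin⟩ := Set.exists_min_image _ id hD h
      refine ⟨a, ?_, hmin⟩
      obtain ⟨⟨b, -, c, -, rfl⟩, hne⟩ := ha
      exact lt_of_le_of_ne (abs_nonneg _) (Ne.symm hne)
  obtain ⟨ε, hε, hmin⟩ := hex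
  refine ⟨ε, hε, fun g hg => Subtype.ext (funext fun x => ?_)⟩
  by_contra hne
  have h1 : ε ≤ |φ.1 x - (g • ψ).1 x| := hmin _
    ⟨⟨_, ⟨x, rfl⟩, _, ⟨g⁻¹ • x, rfl⟩, rfl⟩, by simpa [sub_eq_zero] using hne⟩
  exact absurd (h1.trans (abs_sub_le_dist _ _ _)) (not_le.2 hg)

/-- If the point stabilizers are finite, then `X` is a model for the classifying space of proper
actions. -/
theorem isModelEUnderline_of_finite_stabilizers (ω : ℕ → Fin 3)
    (hfin : ∀ φ : X, {g : G ω | g • φ = φ}.Finite) : IsModelEUnderline.{u} (G ω) X where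
  proper := isProperAction_of_isometric dist_smul_smul (exists_pos_separation ω) hfin
  metrizable := inferInstance
  metrizable_quotient :=
    metrizableSpace_quotient_of_isometric dist_smul_smul (exists_pos_separation ω)
  exists_map _ _ _ hZ _ _ := exists_equivariant_map hZ
  homotopic _ _ _ _ _ _ f₀ f₁ h₀ h₁ := exists_equivariant_homotopy f₀ f₁ h₀ h₁

/-! ## The position of the last letter `1` -/

/-- The last letter `1` of `x` is at position `n`. -/
def IsLast (x : Boundary) (n : ℕ) : Prop := x n = true ∧ ∀ m, n < m → x m = false

/-- The last letter `1` of `x` exists and is at an even position. -/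
def LastEven (x : Boundary) : Prop := ∃ n, IsLast x n ∧ Even n

/-- The sequence `0^∞`. -/
def zeroBd : Boundary := fun _ => false

/-- The sequence with first letter `b`, followed by `y`. -/
def bcons (b : Bool) (y : Boundary) : Boundary
  | 0 => b
  | n + 1 => y n

theorem IsLast.unique {x : Boundary} {m n : ℕ} (hm : IsLast x m) (hn : IsLast x n) : m = n := by
  rcases lt_trichotomy m n with h | h | h
  · exact absurd (hm.2 n h) (by simp [hn.1])
  · exact h
  · exact absurd (hn.2 m h) (by simp [hm.1])

theorem exists_isLast {x : Boundary} (hx : {n | x n = true}.Finite) (h0 : x ≠ zeroBd) :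
    ∃ n, IsLast x n := by
  have hne : {n | x n = true}.Nonempty := by
    by_contra hc
    apply h0
    funext n
    by_contra hn
    exact hc ⟨n, by simpa [zeroBd] using hn⟩
  obtain ⟨n, hn, hmax⟩ := Set.exists_max_image _ id hx hne
  refine ⟨n, hn, fun m hm => ?_⟩
  by_contra hc
  exact absurd (hmax m (by simpa using hc)) (not_le.2 hm)

theorem not_lastEven_zeroBd : ¬ LastEven zeroBd := by
  rintro ⟨n, h, -⟩
  exact Bool.false_ne_true h.1

theorem isLast_bcons_succ {b : Bool} {y : Boundary} {n : ℕ} :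
    IsLast (bcons b y) (n + 1) ↔ IsLast y n := by
  constructor
  · intro h
    exact ⟨h.1, fun m hm => h.2 (m + 1) (by omega)⟩
  · intro h
    refine ⟨h.1, fun m hm => ?_⟩
    obtain ⟨m, rfl⟩ : ∃ k, m = k + 1 := ⟨m - 1, by omega⟩
    exact h.2 m (by omega)

theorem isLast_bcons_zero {b : Bool} {y : Boundary} :
    IsLast (bcons b y) 0 ↔ b = true ∧ y = zeroBd := by
  constructor
  · intro h
    exact ⟨h.1, funext fun m => h.2 (m + 1) (by omega)⟩
  · rintro ⟨rfl, rfl⟩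
    refine ⟨rfl, fun m hm => ?_⟩
    obtain ⟨m, rfl⟩ : ∃ k, m = k + 1 := ⟨m - 1, by omega⟩
    rfl

theorem bcons_finite {b : Bool} {y : Boundary} :
    {n | bcons b y n = true}.Finite ↔ {n | y n = true}.Finite := by
  constructor
  · intro h
    exact h.preimage (f := fun n => n + 1) (add_left_injective 1).injOn
  · intro h
    apply ((h.image (fun n => n + 1)).union (Set.finite_singleton 0)).subset
    rintro (_ | n) hn
    · exact Or.inr rfl
    · exact Or.inl ⟨n, hn, rfl⟩

/-- Prepending a letter shifts the last `1` by one position. Only `y = 0^∞`, which has no last `1`,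
needs separate treatment, and this is why `LastEven` and `ZeroOrLastEven` alternate in the lemmas
below. -/
theorem lastEven_bcons {b : Bool} {y : Boundary} (hy : {n | y n = true}.Finite)
    (h0 : y ≠ zeroBd) : LastEven (bcons b y) ↔ ¬ LastEven y := by
  obtain ⟨n, hn⟩ := exists_isLast hy h0
  have h1 : LastEven y ↔ Even n :=
    ⟨fun ⟨m, hm, he⟩ => hm.unique hn ▸ he, fun he => ⟨n, hn, he⟩⟩
  have h2 : LastEven (bcons b y) ↔ Even (n + 1) :=
    ⟨fun ⟨m, hm, he⟩ => hm.unique (isLast_bcons_succ.2 hn) ▸ he,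
      fun he => ⟨n + 1, isLast_bcons_succ.2 hn, he⟩⟩
  rw [h1, h2, Nat.even_add_one]

theorem bcons_false_zeroBd : bcons false zeroBd = zeroBd := by
  funext n
  cases n <;> rfl

theorem bcons_eq_zeroBd {b : Bool} {y : Boundary} :
    bcons b y = zeroBd ↔ b = false ∧ y = zeroBd := by
  constructor
  · intro h
    exact ⟨congrFun h 0, funext fun n => congrFun h (n + 1)⟩
  · rintro ⟨rfl, rfl⟩
    exact bcons_false_zeroBd

theorem lastEven_bcons_true {y : Boundary} (hy : {n | y n = true}.Finite) :
    LastEven (bcons true y) ↔ ¬ LastEven y := by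
  by_cases h0 : y = zeroBd
  · subst h0
    exact iff_of_true ⟨0, isLast_bcons_zero.2 ⟨rfl, rfl⟩, Even.zero⟩ not_lastEven_zeroBd
  · exact lastEven_bcons hy h0

/-- The letters `1` of `x` end at an even position, or `x` has no letter `1`. -/
def ZeroOrLastEven (x : Boundary) : Prop := x = zeroBd ∨ LastEven x

theorem lastEven_bcons_false {y : Boundary} (hy : {n | y n = true}.Finite) :
    LastEven (bcons false y) ↔ ¬ ZeroOrLastEven y := by
  by_cases h0 : y = zeroBd
  · subst h0
    rw [bcons_false_zeroBd]
    exact iff_of_false not_lastEven_zeroBd (not_not.2 (Or.inl rfl))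
  · rw [lastEven_bcons hy h0, ZeroOrLastEven, or_iff_right h0]

theorem zeroOrLastEven_bcons {b : Bool} {y : Boundary} (hy : {n | y n = true}.Finite) :
    ZeroOrLastEven (bcons b y) ↔ ¬ LastEven y := by
  by_cases h0 : y = zeroBd
  · subst h0
    refine iff_of_true ?_ not_lastEven_zeroBd
    cases b
    · exact Or.inl bcons_false_zeroBd
    · exact Or.inr ((lastEven_bcons_true hy).2 not_lastEven_zeroBd)
  · rw [ZeroOrLastEven, lastEven_bcons hy h0, or_iff_right]
    exact fun h => h0 (bcons_eq_zeroBd.1 h).2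

/-! ## The half-line `Γ₊` -/

/-- An edge moves the last `1` by at most two places: it leaves it alone, or moves it by exactly
two, except near `0^∞`. Parity can thus change only by passing through `0^∞`. -/
theorem lastEven_of_adj {x y : V} (h : Γ.Adj x y) (hx : LastEven x.1) (hy : y ≠ zeroSeq) :
    LastEven y.1 := by
  obtain ⟨n, hn, he⟩ := hx
  rcases h with rfl | ⟨k, hk, rfl⟩
  · rcases Nat.eq_zero_or_pos n with rfl | hpos
    · exfalso
      apply hy
      apply Subtype.ext
      funext m
      rcases Nat.eq_zero_or_pos m with rfl | hm
      · simp [V.flip, flip, zeroSeq, hn.1]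
      · simp [V.flip, flip, zeroSeq, hn.2 m hm, hm.ne']
    · refine ⟨n, ⟨?_, fun m hm => ?_⟩, he⟩
      · simp [V.flip, flip, hn.1, hpos.ne']
      · simp [V.flip, flip, hn.2 m hm, (hpos.trans hm).ne']
  · have hnk : n ≠ k := fun e => by
      have := hn.1
      rw [e, hk.2] at this
      exact Bool.false_ne_true this
    have hlow : ∀ j < k, j ≤ n := fun j hj => by
      by_contra hc
      have := hn.2 j (by omega)
      rw [hk.1 j hj] at this
      exact Bool.false_ne_true this.symm
    rcases lt_trichotomy n (k + 1) with h | h | h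
    -- Here `x = 1^(n+1) 0^∞`, and the flip creates a new last `1` at position `n + 2`.
    · have hk1 : k = n + 1 := by
        have h1 : n < k := by omega
        have := hlow (k - 1) (by omega)
        omega
      subst hk1
      refine ⟨n + 2, ⟨?_, fun m hm => ?_⟩, by simpa [Nat.even_add] using he⟩
      · simp [V.flip, flip, hn.2 (n + 2) (by omega)]
      · have : m ≠ n + 1 + 1 := by omega
        simp [V.flip, flip, this, hn.2 m (by omega)]
    · subst h
      -- The flip erases the last `1` of `1^k 0 1 0^∞`. Evenness of `n = k + 1` excludes `k = 0`, so
      -- the new last `1` is at `k - 1 = n - 2`.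
      obtain ⟨l, rfl⟩ : ∃ l, k = l + 1 := by
        refine ⟨k - 1, ?_⟩
        rcases Nat.eq_zero_or_pos k with rfl | h
        · simp at he
        · omega
      refine ⟨l, ⟨?_, fun m hm => ?_⟩, by simpa [Nat.even_add] using he⟩
      · simp [V.flip, flip, hk.1 l (by omega), show l ≠ l + 1 + 1 by omega]
      · rcases (show m = l + 1 ∨ m = l + 1 + 1 ∨ l + 1 + 1 < m by omega) with rfl | rfl | h
        · simp [V.flip, flip, hk.2]
        · simp [V.flip, flip, hn.1]
        · simp [V.flip, flip, hn.2 m h, h.ne']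
    · refine ⟨n, ⟨?_, fun m hm => ?_⟩, he⟩
      · simp [V.flip, flip, hn.1, h.ne']
      · simp [V.flip, flip, hn.2 m hm, (h.trans hm).ne']

theorem isLast_flip_zeroBd (k : ℕ) : IsLast (flip k zeroBd) k :=
  ⟨by simp [flip, zeroBd], fun m hm => by simp [flip, zeroBd, hm.ne']⟩

theorem mem_ΓPlus_iff (x : V) : x ∈ ΓPlus ↔ ZeroOrLastEven x.1 := by
  constructor
  · rintro (rfl | ⟨p, hp⟩)
    · exact Or.inl rfl
    · right
      have key : ∀ {u v : V} (p : Γ.Walk u v), LastEven u.1 → zeroSeq ∉ p.support →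
          LastEven v.1 := by
        intro u v p
        induction p with
        | nil => exact fun h _ => h
        | cons h p ih =>
          intro hu hp
          rw [SimpleGraph.Walk.support_cons, List.mem_cons, not_or] at hp
          refine ih (lastEven_of_adj h hu ?_) hp.2
          rintro rfl
          exact hp.2 p.start_mem_support
      exact key p ⟨0, isLast_flip_zeroBd 0, Even.zero⟩ hp
  · rintro (h | h)
    · exact Or.inl (Subtype.ext h)
    · right
      -- A walk from `u` to `0^∞` is cut just before it first reaches `0^∞`. The neighbours of `0^∞`
      -- are `10^∞` and `010^∞`, and only the first has its last `1` at an even position.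
      have key : ∀ {u v : V} (p : Γ.Walk u v), v = zeroSeq → LastEven u.1 →
          ∃ q : Γ.Walk oneSeq u, zeroSeq ∉ q.support := by
        intro u v p
        induction p with
        | nil =>
          rintro rfl h
          exact absurd h not_lastEven_zeroBd
        | @cons u w v h p ih =>
          intro hv hu
          have hu0 : zeroSeq ≠ u := by
            rintro rfl
            exact not_lastEven_zeroBd hu
          by_cases hw : w = zeroSeq
          · subst hw
            have : oneSeq = u := by
              rcases h.symm with h | ⟨k, hk, h⟩
              · exact h.symm
              · exfalso
                have hk0 : k = 0 := by
                  by_contra hc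
                  exact Bool.false_ne_true (hk.1 0 (by omega))
                subst hk0
                subst h
                obtain ⟨n, hn, he⟩ := hu
                have := hn.unique (isLast_flip_zeroBd 1)
                subst this
                simp at he
            subst this
            exact ⟨SimpleGraph.Walk.nil, by simpa using hu0⟩
          · obtain ⟨q, hq⟩ := ih hv (lastEven_of_adj h hu hw)
            refine ⟨q.concat h.symm, ?_⟩
            rw [SimpleGraph.Walk.support_concat]
            simp only [List.mem_append, List.mem_singleton, not_or]
            exact ⟨hq, hu0⟩
      obtain ⟨n, hn, -⟩ := id h
      obtain ⟨p⟩ : Γ.Reachable x zeroSeq :=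
        reachable_of_agree (n + 1) _ _ fun m hm => hn.2 m (by omega)
      exact key p rfl h

/-! ## Sections of tree automorphisms -/

/-- The image of the letter `b` under the action of `g` on the first level of the tree. -/
def rt (g : TreeAut) (b : Bool) : Bool := (g.1 [b]).headD false

/-- The section of `g` at the vertex `b` of the first level, as a function on words. -/
def secFun (g : TreeAut) (b : Bool) (w : List Bool) : List Bool := (g.1 (b :: w)).tail

theorem apply_cons (g : TreeAut) (b : Bool) (w : List Bool) :
    g.1 (b :: w) = rt g b :: secFun g b w := by
  have hp : g.1 [b] <+: g.1 (b :: w) := (g.2.2 _ _).2 ⟨w, rfl⟩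
  obtain ⟨c, hc⟩ := List.length_eq_one_iff.1 (show (g.1 [b]).length = 1 from g.2.1 [b])
  obtain ⟨t, ht⟩ := hp
  rw [rt, secFun, ← ht, hc]
  rfl

theorem apply_singleton (g : TreeAut) (b : Bool) : g.1 [b] = [rt g b] := by
  obtain ⟨c, hc⟩ := List.length_eq_one_iff.1 (show (g.1 [b]).length = 1 from g.2.1 [b])
  rw [rt, hc]
  rfl

theorem inv_apply_apply (g : TreeAut) (w : List Bool) : (g⁻¹).1 (g.1 w) = w :=
  g.1.symm_apply_apply w

theorem secFun_inv_secFun (g : TreeAut) (b : Bool) (w : List Bool) :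
    secFun g⁻¹ (rt g b) (secFun g b w) = w := by
  have h := inv_apply_apply g (b :: w)
  rw [apply_cons, apply_cons] at h
  exact (List.cons.inj h).2

theorem rt_inv_rt (g : TreeAut) (b : Bool) : rt g⁻¹ (rt g b) = b := by
  have h := inv_apply_apply g [b]
  rw [apply_singleton, apply_singleton] at h
  exact (List.cons.inj h).1

/-- The section of `g` at the vertex `b` of the first level. -/
def sec (g : TreeAut) (b : Bool) : TreeAut :=
  ⟨⟨secFun g b, secFun g⁻¹ (rt g b), secFun_inv_secFun g b, fun w => by
      have h := secFun_inv_secFun g⁻¹ (rt g b) w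
      rwa [rt_inv_rt, inv_inv] at h⟩, by
    refine ⟨fun u => ?_, fun u v => ?_⟩
    · have h := g.2.1 (b :: u)
      rw [apply_cons] at h
      simpa using h
    · have h := g.2.2 (b :: u) (b :: v)
      rw [apply_cons, apply_cons, List.cons_prefix_cons, List.cons_prefix_cons] at h
      simpa using h⟩

theorem apply_cons_sec (g : TreeAut) (b : Bool) (w : List Bool) :
    g.1 (b :: w) = rt g b :: (sec g b).1 w := apply_cons g b w

theorem treeAut_ext {g h : TreeAut} (hr : ∀ b, rt g b = rt h b) (hs : ∀ b, sec g b = sec h b) :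
    g = h := by
  apply Subtype.ext
  apply Equiv.ext
  rintro (_ | ⟨b, w⟩)
  · rw [List.length_eq_zero_iff.1 (g.2.1 []), List.length_eq_zero_iff.1 (h.2.1 [])]
  · rw [apply_cons_sec, apply_cons_sec, hr, hs]

theorem mul_apply_TreeAut (g h : TreeAut) (w : List Bool) : (g * h).1 w = g.1 (h.1 w) := rfl

theorem rt_mul (g h : TreeAut) (b : Bool) : rt (g * h) b = rt g (rt h b) := by
  have e := apply_singleton (g * h) b
  rw [mul_apply_TreeAut, apply_singleton, apply_singleton] at e
  exact (List.cons.inj e).1.symm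

theorem sec_mul (g h : TreeAut) (b : Bool) : sec (g * h) b = sec g (rt h b) * sec h b := by
  apply Subtype.ext
  apply Equiv.ext
  intro w
  have e := apply_cons_sec (g * h) b w
  rw [mul_apply_TreeAut, apply_cons_sec, apply_cons_sec] at e
  exact (List.cons.inj e).2.symm

theorem sec_one (b : Bool) : sec 1 b = 1 := rfl

theorem rt_eq_xor (g : TreeAut) (b : Bool) : rt g b = (b ^^ rt g false) := by
  have h1 := rt_inv_rt g false
  have h2 := rt_inv_rt g true
  cases b
  · simp
  · cases hf : rt g false <;> cases ht : rt g true <;> simp_all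

theorem smul_bcons (g : TreeAut) (b : Bool) (y : Boundary) :
    g • bcons b y = bcons (rt g b) (sec g b • y) := by
  have hp : ∀ n, pref (bcons b y) (n + 1) = b :: pref y n := fun n => pref_succ _ _
  funext n
  rw [smul_apply, hp, apply_cons_sec]
  cases n with
  | zero => rfl
  | succ n => rfl

theorem rt_aAut (b : Bool) : rt aAut b = !b := rfl

theorem sec_aAut (b : Bool) : sec aAut b = 1 := rfl

theorem rt_genAut (i : Fin 3) (ω : ℕ → Fin 3) (b : Bool) : rt (genAut i ω) b = b := by
  change (genFun i ω [b]).headD false = b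
  cases b
  · by_cases h : ω 0 = i <;> simp [genFun, h]
  · simp [genFun]

theorem sec_genAut_true (i : Fin 3) (ω : ℕ → Fin 3) :
    sec (genAut i ω) true = genAut i (shift ω) := rfl

theorem sec_genAut_false (i : Fin 3) (ω : ℕ → Fin 3) :
    sec (genAut i ω) false = if ω 0 = i then 1 else aAut := by
  apply Subtype.ext
  apply Equiv.ext
  intro w
  change (genFun i ω (false :: w)).tail = _
  by_cases h : ω 0 = i
  · simp [genFun, h]
  · simp only [genFun, h, if_false]
    rfl

theorem aAut_mem_G (ω : ℕ → Fin 3) : aAut ∈ G ω := Subgroup.subset_closure (by simp [gens])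

theorem genAut_mem_G (i : Fin 3) (ω : ℕ → Fin 3) : genAut i ω ∈ G ω :=
  Subgroup.subset_closure (genAut_mem i ω)

theorem eq_of_mem_gens {ω : ℕ → Fin 3} {s : TreeAut} (hs : s ∈ gens ω) :
    s = aAut ∨ ∃ i, s = genAut i ω := by
  simp only [gens, Set.mem_insert_iff, Set.mem_singleton_iff] at hs
  rcases hs with rfl | rfl | rfl | rfl
  · exact Or.inl rfl
  all_goals exact Or.inr ⟨_, rfl⟩

/-- Induction on the elements of `G_ω`, which is generated by involutions. -/
theorem G_induction {ω : ℕ → Fin 3} {p : TreeAut → Prop} (one : p 1) (a : p aAut)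
    (gen : ∀ i, p (genAut i ω)) (mul : ∀ g h, g ∈ G ω → h ∈ G ω → p g → p h → p (g * h))
    {g : TreeAut} (hg : g ∈ G ω) : p g := by
  have hgen : ∀ s ∈ gens ω, p s := by
    intro s hs
    rcases eq_of_mem_gens hs with rfl | ⟨i, rfl⟩
    · exact a
    · exact gen i
  refine Subgroup.closure_induction'' (p := fun g _ => p g) (fun s hs => hgen s hs)
    (fun s hs => ?_) one (fun g h hg hh => mul g h hg hh) hg
  rw [inv_eq_of_mul_eq_one_left (gens_mul_self hs)]
  exact hgen s hs

theorem sec_mem_G {ω : ℕ → Fin 3} {g : TreeAut} (hg : g ∈ G ω) (b : Bool) :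
    sec g b ∈ G (shift ω) := by
  refine G_induction (p := fun g => ∀ b, sec g b ∈ G (shift ω)) (fun b => ?_) (fun b => ?_)
    (fun i b => ?_) (fun g h _ _ ihg ihh b => ?_) hg b
  · rw [sec_one]; exact one_mem _
  · rw [sec_aAut]; exact one_mem _
  · cases b
    · rw [sec_genAut_false]
      split_ifs
      · exact one_mem _
      · exact aAut_mem_G _
    · exact genAut_mem_G i _
  · rw [sec_mul]
    exact mul_mem (ihg _) (ihh _)

/-! ## Automorphisms preserving a set of boundary points -/

/-- `g` preserves the set of the finitely supported sequences that satisfy `W`. -/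
def Pres (W : Boundary → Prop) (g : TreeAut) : Prop :=
  ∀ x : Boundary, {n | x n = true}.Finite → (W (g • x) ↔ W x)

theorem Pres.mul {ω : ℕ → Fin 3} {W : Boundary → Prop} {g h : TreeAut} (hg : Pres W g)
    (hh : Pres W h) (hG : h ∈ G ω) : Pres W (g * h) := fun x hx => by
  rw [mul_smul, hg _ (smul_finite hG hx), hh x hx]

theorem Pres.inv {ω : ℕ → Fin 3} {W : Boundary → Prop} {g : TreeAut} (hg : Pres W g)
    (hG : g ∈ G ω) : Pres W g⁻¹ := fun x hx => by
  rw [← hg _ (smul_finite (inv_mem hG) hx), smul_inv_smul]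

theorem pres_congr {ω : ℕ → Fin 3} {W W' : Boundary → Prop} {g : TreeAut} (hG : g ∈ G ω)
    (h : ∀ x : Boundary, {n | x n = true}.Finite → (W x ↔ W' x)) : Pres W g ↔ Pres W' g :=
  forall₂_congr fun x hx => by rw [h x hx, h _ (smul_finite hG hx)]

theorem pres_not {W : Boundary → Prop} {g : TreeAut} : Pres (fun x => ¬ W x) g ↔ Pres W g :=
  forall₂_congr fun _ _ => not_iff_not

/-- Sections of an automorphism that preserves a set and fixes the first level. -/
theorem pres_sec {W : Boundary → Prop} {g : TreeAut} (hg : Pres W g) {b : Bool}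
    (hb : rt g b = b) : Pres (fun y => W (bcons b y)) (sec g b) := fun y hy => by
  have h := hg (bcons b y) (bcons_finite.2 hy)
  rwa [smul_bcons, hb] at h

theorem pres_sec_lastEven_true {ω : ℕ → Fin 3} {g : TreeAut} (hG : g ∈ G ω)
    (hg : Pres LastEven g) (hb : rt g true = true) : Pres LastEven (sec g true) := by
  have h := pres_sec hg hb
  rwa [pres_congr (sec_mem_G hG true) (W' := fun y => ¬ LastEven y)
    fun x hx => lastEven_bcons_true hx, pres_not] at h

theorem pres_sec_lastEven_false {ω : ℕ → Fin 3} {g : TreeAut} (hG : g ∈ G ω)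
    (hg : Pres LastEven g) (hb : rt g false = false) : Pres ZeroOrLastEven (sec g false) := by
  have h := pres_sec hg hb
  rwa [pres_congr (sec_mem_G hG false) (W' := fun y => ¬ ZeroOrLastEven y)
    fun x hx => lastEven_bcons_false hx, pres_not] at h

theorem pres_sec_zeroOrLastEven {ω : ℕ → Fin 3} {g : TreeAut} (hG : g ∈ G ω)
    (hg : Pres ZeroOrLastEven g) {b : Bool} (hb : rt g b = b) : Pres LastEven (sec g b) := by
  have h := pres_sec hg hb
  rwa [pres_congr (sec_mem_G hG b) (W' := fun y => ¬ LastEven y)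
    fun x hx => zeroOrLastEven_bcons hx, pres_not] at h

theorem bcons_tail (x : Boundary) : bcons (x 0) (tail x) = x := by
  funext n
  cases n <;> rfl

/-- By `zeroOrLastEven_bcons`, membership in this set does not depend on the first letter, the only
one that `a` changes. -/
theorem pres_aAut : Pres ZeroOrLastEven aAut := fun x hx => by
  rw [← bcons_tail x] at hx ⊢
  rw [bcons_finite] at hx
  rw [smul_bcons, sec_aAut, one_smul, zeroOrLastEven_bcons hx, zeroOrLastEven_bcons hx]

/-! ## The flow through the cut at `Γ₊` -/

/-- The indicator function of `Γ₊` with integer values. -/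
noncomputable def indZ (x : V) : ℤ := ΓPlus.indicator 1 x

theorem finite_support_flow {ω : ℕ → Fin 3} (g : G ω) :
    (Function.support fun x => indZ (g • x) - indZ x).Finite := by
  apply (commensurate g).subset
  intro x hx h
  apply hx
  by_cases hx' : x ∈ ΓPlus
  · simp [indZ, hx', h.2 hx']
  · simp [indZ, hx', mt h.1 hx']

/-- The number of points that `g` moves into `Γ₊` minus the number of points that it moves out. -/
noncomputable def flow {ω : ℕ → Fin 3} (g : G ω) : ℤ := ∑ᶠ x, (indZ (g • x) - indZ x)

/-- The summand for `g * h` telescopes through `h • x`, and the sum for `g` may be reindexed by the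
permutation `h`. -/
theorem flow_mul {ω : ℕ → Fin 3} (g h : G ω) : flow (g * h) = flow g + flow h := by
  have h1 : flow g = ∑ᶠ x, (indZ (g • h • x) - indZ (h • x)) :=
    (finsum_comp_equiv (MulAction.toPerm h : Equiv.Perm V)
      (f := fun x => indZ (g • x) - indZ x)).symm
  rw [h1, flow, flow, ← finsum_add_distrib]
  · refine finsum_congr fun x => ?_
    rw [mul_smul]
    ring
  · exact (finite_support_flow g).preimage (f := fun x : V => h • x) (MulAction.injective h).injOn
  · exact finite_support_flow h

theorem flow_one {ω : ℕ → Fin 3} : flow (1 : G ω) = 0 := by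
  simp [flow]

/-- A homomorphism to the torsion-free group `ℤ` kills involutions, and these generate `G ω`. -/
theorem flow_eq_zero {ω : ℕ → Fin 3} {g : TreeAut} (hg : g ∈ G ω) : flow (⟨g, hg⟩ : G ω) = 0 := by
  have inv : ∀ s : G ω, s.1 ∈ gens ω → flow s = 0 := fun s hs => by
    have e : s * s = 1 := Subtype.ext (gens_mul_self hs)
    have h := flow_mul s s
    rw [e, flow_one] at h
    omega
  refine G_induction (p := fun g => ∀ hg : g ∈ G ω, flow (⟨g, hg⟩ : G ω) = 0) (fun _ => flow_one)
    (fun h => inv _ (by simp [gens])) (fun i h => inv _ (genAut_mem i ω)) ?_ hg hg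
  intro g h hg hh ihg ihh _
  exact (flow_mul ⟨g, hg⟩ ⟨h, hh⟩).trans (by rw [ihg, ihh, add_zero])

/-- An element of `G_ω` that preserves `Γ₊ ∖ {0^∞}` fixes the first level. -/
theorem rt_eq_of_pres_lastEven {ω : ℕ → Fin 3} {g : TreeAut} (hG : g ∈ G ω)
    (hg : Pres LastEven g) (b : Bool) : rt g b = b := by
  cases hf : rt g false
  · rw [rt_eq_xor, hf, Bool.xor_false]
  · exfalso
    classical
    let h : G (shift ω) := ⟨sec g false, sec_mem_G hG false⟩
    -- If `g` exchanged the two subtrees, its section at `0` would send `ΓPlus` onto `ΓPlus ∖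
    -- {0^∞}`. Exactly one point, the preimage of `0^∞`, then moves into `ΓPlus` and none moves out,
    -- giving flow one.
    have key : ∀ y : V, LastEven (h • y).1 ↔ ZeroOrLastEven y.1 := by
      intro y
      have e := hg (bcons false y.1) (bcons_finite.2 y.2)
      rw [smul_bcons, hf, lastEven_bcons_true (smul_finite h.2 y.2), lastEven_bcons_false y.2,
        not_iff_not] at e
      exact e
    have hval : ∀ y : V, indZ (h • y) - indZ y = if y = h⁻¹ • zeroSeq then 1 else 0 := by
      intro y
      by_cases hy : y = h⁻¹ • zeroSeq
      · subst hy
        have h1 : zeroSeq ∈ ΓPlus := Or.inl rfl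
        have h2 : h⁻¹ • zeroSeq ∉ ΓPlus := by
          rw [mem_ΓPlus_iff, ← key, smul_inv_smul]
          exact not_lastEven_zeroBd
        simp [indZ, h1, h2]
      · have h1 : (h • y).1 ≠ zeroBd := fun e => hy (by
          rw [eq_inv_smul_iff]
          exact Subtype.ext e)
        have h2 : h • y ∈ ΓPlus ↔ y ∈ ΓPlus := by
          rw [mem_ΓPlus_iff, mem_ΓPlus_iff, ← key y, ZeroOrLastEven, or_iff_right h1]
        by_cases h3 : y ∈ ΓPlus
        · simp [indZ, h3, h2.2 h3, hy]
        · simp [indZ, h3, mt h2.1 h3, hy]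
    have e := flow_eq_zero h.2
    rw [flow, finsum_congr hval, finsum_eq_single _ (h⁻¹ • zeroSeq) (fun y hy => if_neg hy),
      if_pos rfl] at e
    exact one_ne_zero e

/-! ## The group `{1, b_ω, c_ω, d_ω}` and word length -/

theorem genAut_mul_self (i : Fin 3) (ω : ℕ → Fin 3) : genAut i ω * genAut i ω = 1 :=
  gens_mul_self (genAut_mem i ω)

theorem genFun_comp {i j k : Fin 3} (hij : i ≠ j) (hik : i ≠ k) (hjk : j ≠ k) (ω : ℕ → Fin 3)
    (w : List Bool) : genFun i ω (genFun j ω w) = genFun k ω w := by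
  induction w generalizing ω with
  | nil => simp [genFun]
  | cons b w ih =>
    cases b with
    | true => simp [genFun, ih]
    | false =>
      have h : ω 0 = i ∨ ω 0 = j ∨ ω 0 = k := by omega
      rcases h with h | h | h
      · simp [genFun, h, hij, hik]
      · simp [genFun, h, hij.symm, hjk]
      · simp [genFun, h, hik.symm, hjk.symm, aFun_aFun]

theorem genAut_mul {i j k : Fin 3} (hij : i ≠ j) (hik : i ≠ k) (hjk : j ≠ k) (ω : ℕ → Fin 3) :
    genAut i ω * genAut j ω = genAut k ω :=
  Subtype.ext (Equiv.ext (genFun_comp hij hik hjk ω))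

/-- The Klein four-group `{1, b_ω, c_ω, d_ω}`. -/
def V4 (ω : ℕ → Fin 3) : Subgroup TreeAut where
  carrier := {g | g = 1 ∨ ∃ i, g = genAut i ω}
  one_mem' := Or.inl rfl
  mul_mem' := by
    rintro g h (rfl | ⟨i, rfl⟩) (rfl | ⟨j, rfl⟩)
    · exact Or.inl (one_mul 1)
    · exact Or.inr ⟨j, one_mul _⟩
    · exact Or.inr ⟨i, mul_one _⟩
    · by_cases hij : i = j
      · subst hij
        exact Or.inl (genAut_mul_self i ω)
      · obtain ⟨k, hik, hjk⟩ : ∃ k : Fin 3, i ≠ k ∧ j ≠ k := by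
          revert i j
          decide
        exact Or.inr ⟨k, genAut_mul hij hik hjk ω⟩
  inv_mem' := by
    rintro g (rfl | ⟨i, rfl⟩)
    · exact Or.inl inv_one
    · exact Or.inr ⟨i, inv_eq_of_mul_eq_one_left (genAut_mul_self i ω)⟩

theorem V4_le_G (ω : ℕ → Fin 3) : V4 ω ≤ G ω := by
  rintro g (rfl | ⟨i, rfl⟩)
  · exact one_mem _
  · exact genAut_mem_G i ω

theorem V4_finite (ω : ℕ → Fin 3) : (V4 ω : Set TreeAut).Finite := by
  apply ((Set.finite_singleton 1).union (Set.finite_range fun i => genAut i ω)).subset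
  rintro g (rfl | ⟨i, rfl⟩)
  · exact Or.inl rfl
  · exact Or.inr ⟨i, rfl⟩

theorem rt_of_mem_V4 {ω : ℕ → Fin 3} {g : TreeAut} (hg : g ∈ V4 ω) (b : Bool) : rt g b = b := by
  rcases hg with rfl | ⟨i, rfl⟩
  · rfl
  · exact rt_genAut i ω b

theorem sec_true_of_mem_V4 {ω : ℕ → Fin 3} {g : TreeAut} (hg : g ∈ V4 ω) :
    sec g true ∈ V4 (shift ω) := by
  rcases hg with rfl | ⟨i, rfl⟩
  · exact Or.inl rfl
  · exact Or.inr ⟨i, rfl⟩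

theorem sec_false_of_mem_V4 {ω : ℕ → Fin 3} {g : TreeAut} (hg : g ∈ V4 ω) :
    sec g false = 1 ∨ sec g false = aAut := by
  rcases hg with rfl | ⟨i, rfl⟩
  · exact Or.inl rfl
  · rw [sec_genAut_false]
    split_ifs
    · exact Or.inl rfl
    · exact Or.inr rfl

/-- Moving along an edge can leave the set only by landing on `0^∞`. The preimage of `0^∞` under
this involution is `0^∞` or `010^∞`, and neither is in the set. -/
theorem pres_lastEven_genAut (i : Fin 3) (ω : ℕ → Fin 3) : Pres LastEven (genAut i ω) := by
  have key : ∀ x : V, LastEven x.1 → LastEven (genAut i ω • x.1) := by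
    intro x hx
    rcases smul_adj_or_eq (s := (⟨genAut i ω, genAut_mem_G i ω⟩ : G ω)) (genAut_mem i ω) x with h | h
    · have e : genAut i ω • x.1 = x.1 := congrArg Subtype.val h
      rwa [e]
    · refine lastEven_of_adj h hx fun e => ?_
      have e1 : genAut i ω • x.1 = zeroBd := congrArg Subtype.val e
      have e2 : x.1 = genAut i ω • zeroBd := by rw [← e1, gens_smul_smul (genAut_mem i ω)]
      have hz : FirstZero zeroBd 0 := ⟨by simp, rfl⟩
      rw [genAut_smul i ω hz] at e2
      split_ifs at e2
      · rw [e2] at hx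
        exact not_lastEven_zeroBd hx
      · rw [e2] at hx
        obtain ⟨n, hn, he⟩ := hx
        obtain rfl := hn.unique (isLast_flip_zeroBd 1)
        simp at he
  intro x hx
  refine ⟨fun h => ?_, fun h => key ⟨x, hx⟩ h⟩
  have := key ⟨_, smul_finite (genAut_mem_G i ω) hx⟩ h
  rwa [gens_smul_smul (genAut_mem i ω)] at this

theorem pres_lastEven_of_mem_V4 {ω : ℕ → Fin 3} {g : TreeAut} (hg : g ∈ V4 ω) :
    Pres LastEven g := by
  rcases hg with rfl | ⟨i, rfl⟩
  · intro x _
    rw [one_smul]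
  · exact pres_lastEven_genAut i ω

/-- The products `s₀ a s₁ a ⋯ a sₘ` with `m ≤ n` and `sᵢ ∈ {1, b_ω, c_ω, d_ω}`. -/
def Words (ω : ℕ → Fin 3) : ℕ → Set TreeAut
  | 0 => V4 ω
  | n + 1 => {g | g ∈ Words ω n ∨ ∃ h ∈ Words ω n, ∃ s ∈ V4 ω, g = h * aAut * s}

theorem words_mono (ω : ℕ → Fin 3) {m n : ℕ} (h : m ≤ n) : Words ω m ⊆ Words ω n := by
  induction h with
  | refl => exact subset_rfl
  | step _ ih => exact fun g hg => Or.inl (ih hg)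

theorem words_mul_mem {ω : ℕ → Fin 3} {n : ℕ} {g s : TreeAut} (hg : g ∈ Words ω n)
    (hs : s ∈ V4 ω) : g * s ∈ Words ω n := by
  induction n generalizing g with
  | zero => exact mul_mem hg hs
  | succ n ih =>
    rcases hg with hg | ⟨h, hh, t, ht, rfl⟩
    · exact Or.inl (ih hg)
    · exact Or.inr ⟨h, hh, t * s, mul_mem ht hs, by rw [mul_assoc]⟩

theorem words_mul_aAut {ω : ℕ → Fin 3} {n : ℕ} {g : TreeAut} (hg : g ∈ Words ω n) :
    g * aAut ∈ Words ω (n + 1) :=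
  Or.inr ⟨g, hg, 1, one_mem _, (mul_one _).symm⟩

theorem exists_words {ω : ℕ → Fin 3} {g : TreeAut} (hg : g ∈ G ω) : ∃ n, g ∈ Words ω n := by
  have step : ∀ (x : TreeAut) (y : TreeAut), y ∈ gens ω → (∃ n, x ∈ Words ω n) →
      ∃ n, x * y ∈ Words ω n := by
    rintro x y hy ⟨n, hn⟩
    rcases eq_of_mem_gens hy with rfl | ⟨i, rfl⟩
    · exact ⟨n + 1, words_mul_aAut hn⟩
    · exact ⟨n, words_mul_mem hn (Or.inr ⟨i, rfl⟩)⟩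
  refine Subgroup.closure_induction_right (p := fun g _ => ∃ n, g ∈ Words ω n)
    ⟨0, one_mem (V4 ω)⟩ (fun x _ y hy hx => step x y hy hx) (fun x _ y hy hx => ?_) hg
  rw [inv_eq_of_mul_eq_one_left (gens_mul_self hy)]
  exact step x y hy hx

/-- Taking sections halves the length of words. -/
theorem sec_mem_words {ω : ℕ → Fin 3} {n : ℕ} {g : TreeAut} (hg : g ∈ Words ω n) :
    sec g true ∈ Words (shift ω) ((n + 1) / 2) ∧ sec g false ∈ Words (shift ω) ((n + 2) / 2) := by
  induction n generalizing g with
  | zero =>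
    refine ⟨sec_true_of_mem_V4 hg, ?_⟩
    rcases sec_false_of_mem_V4 hg with h | h
    · rw [h]
      exact Or.inl (one_mem (V4 _))
    · rw [h]
      exact Or.inr ⟨1, one_mem (V4 _), 1, one_mem _, by simp⟩
  | succ n ih =>
    rcases hg with hg | ⟨h, hh, s, hs, rfl⟩
    · exact ⟨words_mono _ (by omega) (ih hg).1, words_mono _ (by omega) (ih hg).2⟩
    · have e : ∀ b, sec (h * aAut * s) b = sec h (!b) * sec s b := fun b => by
        rw [sec_mul, sec_mul, rt_of_mem_V4 hs, sec_aAut, mul_one, rt_aAut]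
      constructor
      · rw [e]
        exact words_mul_mem (ih hh).2 (sec_true_of_mem_V4 hs)
      · have h2 : (n + 1 + 2) / 2 = (n + 1) / 2 + 1 := by omega
        rw [e, h2]
        rcases sec_false_of_mem_V4 hs with h | h
        · rw [h, mul_one]
          exact Or.inl (ih hh).1
        · rw [h]
          exact words_mul_aAut (ih hh).1

/-- A word of positive length begins with `s a` for some `s ∈ {1, b_ω, c_ω, d_ω}`. -/
theorem words_eq_left {ω : ℕ → Fin 3} {n : ℕ} {g : TreeAut} (hg : g ∈ Words ω n) :
    g ∈ V4 ω ∨ ∃ m < n, ∃ s ∈ V4 ω, ∃ h ∈ Words ω m, g = s * aAut * h := by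
  induction n generalizing g with
  | zero => exact Or.inl hg
  | succ n ih =>
    rcases hg with hg | ⟨h, hh, t, ht, rfl⟩
    · rcases ih hg with h | ⟨m, hm, h⟩
      · exact Or.inl h
      · exact Or.inr ⟨m, by omega, h⟩
    · right
      rcases ih hh with h' | ⟨m, hm, s, hs, h', hh', rfl⟩
      · exact ⟨0, by omega, h, h', t, ht, rfl⟩
      · exact ⟨m + 1, by omega, s, hs, h' * aAut * t, Or.inr ⟨h', hh', t, ht, rfl⟩, by group⟩

/-- Elements of `V4` preserve `ΓPlus ∖ {0^∞}`, so the outer factors `s` and `t` can be stripped off.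
Exposing an `a` on both sides of the core is what makes the sections short enough for the induction.
-/
theorem words_eq_middle {ω : ℕ → Fin 3} {n : ℕ} {g : TreeAut} (hg : g ∈ Words ω n) :
    g ∈ V4 ω ∨ ∃ s ∈ V4 ω, ∃ t ∈ V4 ω, g = s * aAut * t ∨
      ∃ m, m + 2 ≤ n ∧ ∃ h ∈ Words ω m, g = s * (aAut * h * aAut) * t := by
  induction n generalizing g with
  | zero => exact Or.inl hg
  | succ n ih =>
    rcases hg with hg | ⟨h, hh, t, ht, rfl⟩
    · rcases ih hg with h | ⟨s, hs, t, ht, h | ⟨m, hm, h⟩⟩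
      · exact Or.inl h
      · exact Or.inr ⟨s, hs, t, ht, Or.inl h⟩
      · exact Or.inr ⟨s, hs, t, ht, Or.inr ⟨m, by omega, h⟩⟩
    · right
      rcases words_eq_left hh with h' | ⟨m, hm, s, hs, h', hh', rfl⟩
      · exact ⟨h, h', t, ht, Or.inl rfl⟩
      · exact ⟨s, hs, t, ht, Or.inr ⟨m, by omega, h', hh', by group⟩⟩

/-! ## Parities of tree automorphisms -/

/-- The parity of the action of `g` on the first level. -/
def rootParity (g : TreeAut) : ZMod 2 := if rt g false then 1 else 0

theorem rootParity_mul (g h : TreeAut) : rootParity (g * h) = rootParity g + rootParity h := by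
  simp only [rootParity, rt_mul]
  rw [rt_eq_xor g (rt h false)]
  cases rt h false <;> cases rt g false <;> decide

theorem rt_true_eq_not (g : TreeAut) : rt g true = !rt g false := by
  rw [rt_eq_xor g true, Bool.true_xor]

/-- The parity of the number of vertices of level `n` at which `g` permutes the two children. -/
def levelParity : ℕ → TreeAut → ZMod 2
  | 0, g => rootParity g
  | n + 1, g => levelParity n (sec g false) + levelParity n (sec g true)

theorem levelParity_mul (n : ℕ) (g h : TreeAut) :
    levelParity n (g * h) = levelParity n g + levelParity n h := by
  induction n generalizing g h with
  | zero => exact rootParity_mul g h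
  | succ n ih =>
    simp only [levelParity, sec_mul, ih, rt_true_eq_not]
    cases rt h false <;> simp only [Bool.not_false, Bool.not_true] <;> ring

theorem levelParity_one (n : ℕ) : levelParity n 1 = 0 := by
  have h := levelParity_mul n 1 1
  rwa [mul_one, left_eq_add] at h

theorem levelParity_succ_aAut (n : ℕ) : levelParity (n + 1) aAut = 0 := by
  rw [levelParity, sec_aAut, sec_aAut, levelParity_one, add_zero]

theorem levelParity_succ_genAut (n : ℕ) (i : Fin 3) (ω : ℕ → Fin 3) :
    levelParity (n + 1) (genAut i ω) = if ω n = i then 0 else 1 := by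
  induction n generalizing ω with
  | zero =>
    have h : levelParity 0 (genAut i (shift ω)) = 0 := by
      simp [levelParity, rootParity, rt_genAut]
    rw [levelParity, sec_genAut_true, sec_genAut_false, h, add_zero]
    split_ifs
    · exact levelParity_one 0
    · rfl
  | succ n ih =>
    rw [levelParity, sec_genAut_true, sec_genAut_false, ih]
    have h : levelParity (n + 1) (if ω 0 = i then 1 else aAut) = 0 := by
      split_ifs
      · exact levelParity_one _
      · exact levelParity_succ_aAut n
    rw [h, zero_add]
    rfl

/-- `χ` is a homomorphism to `ℤ/2` that vanishes on `a` and, among `b_ω`, `c_ω`, `d_ω`, exactly on the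
one with index `i`. -/
structure IsParity (ω : ℕ → Fin 3) (i : Fin 3) (χ : TreeAut → ZMod 2) : Prop where
  map_mul : ∀ g h, χ (g * h) = χ g + χ h
  map_aAut : χ aAut = 0
  map_genAut : ∀ j, χ (genAut j ω) = if i = j then 0 else 1

theorem IsParity.map_one {ω : ℕ → Fin 3} {i : Fin 3} {χ : TreeAut → ZMod 2} (h : IsParity ω i χ) :
    χ 1 = 0 := by
  have h := h.map_mul 1 1
  rwa [mul_one, left_eq_add] at h

/-- If the index `i` occurs as `ω n`, counting swaps at level `n + 1` works. -/
theorem exists_isParity {ω : ℕ → Fin 3} (hω : ω 0 ≠ ω 1) (i : Fin 3) :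
    ∃ χ, IsParity ω i χ := by
  by_cases h : ∃ n, ω n = i
  · obtain ⟨n, rfl⟩ := h
    exact ⟨levelParity (n + 1), levelParity_mul _, levelParity_succ_aAut n,
      fun j => levelParity_succ_genAut n j ω⟩
  · push Not at h
    -- If `i` never occurs, then `ω 0` and `ω 1` are the two other indices. The sum of their
    -- parities vanishes on the generator with index `i` and is one on the other two.
    refine ⟨fun g => levelParity 1 g + levelParity 2 g, fun g k => ?_, ?_, fun j => ?_⟩
    · simp only [levelParity_mul]
      ring
    · rw [levelParity_succ_aAut 0, levelParity_succ_aAut 1, add_zero]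
    · rw [levelParity_succ_genAut 0, levelParity_succ_genAut 1]
      have h0 := h 0
      have h1 := h 1
      generalize ω 0 = x at *
      generalize ω 1 = y at *
      clear h
      revert x y i j
      decide

/-- The sum of a parity over the two sections. -/
def secParity (χ : TreeAut → ZMod 2) (g : TreeAut) : ZMod 2 := χ (sec g false) + χ (sec g true)

/-- The parity of the section at the letter `1`. -/
def secTrueParity (χ : TreeAut → ZMod 2) (g : TreeAut) : ZMod 2 := χ (sec g true)

theorem secParity_mul {χ : TreeAut → ZMod 2} (hχ : ∀ g h, χ (g * h) = χ g + χ h)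
    (g h : TreeAut) : secParity χ (g * h) = secParity χ g + secParity χ h := by
  simp only [secParity, sec_mul, hχ, rt_true_eq_not]
  cases rt h false <;> simp only [Bool.not_false, Bool.not_true] <;> ring

/-- With `rootParity` and `secParity`, this function gives coordinates on the wreath product of two
groups of order two. The correction term records that a root swap of `h` exchanges the sections of
`g`. -/
theorem secTrueParity_mul {χ : TreeAut → ZMod 2} (hχ : ∀ g h, χ (g * h) = χ g + χ h)
    (g h : TreeAut) : secTrueParity χ (g * h) =
      secTrueParity χ g + secTrueParity χ h + rootParity h * secParity χ g := by
  simp only [secParity, secTrueParity, rootParity, sec_mul, hχ, rt_true_eq_not]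
  cases rt h false <;> simp only [Bool.not_false, Bool.not_true] <;>
    generalize χ (sec g false) = x <;> generalize χ (sec g true) = y <;>
    generalize χ (sec h true) = z <;> revert x y z <;> decide

theorem rootParity_aAut : rootParity aAut = 1 := rfl

theorem rootParity_of_fixed {g : TreeAut} (hg : rt g false = false) : rootParity g = 0 := by
  simp [rootParity, hg]

theorem IsParity.secParity_one {ω : ℕ → Fin 3} {i : Fin 3} {χ : TreeAut → ZMod 2}
    (h : IsParity ω i χ) : secParity χ 1 = 0 := by
  rw [secParity, sec_one, sec_one, h.map_one, add_zero]

theorem IsParity.secParity_aAut {ω : ℕ → Fin 3} {i : Fin 3} {χ : TreeAut → ZMod 2}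
    (h : IsParity ω i χ) : secParity χ aAut = 0 := by
  rw [secParity, sec_aAut, sec_aAut, h.map_one, add_zero]

theorem IsParity.secTrueParity_one {ω : ℕ → Fin 3} {i : Fin 3} {χ : TreeAut → ZMod 2}
    (h : IsParity ω i χ) : secTrueParity χ 1 = 0 := h.map_one

theorem IsParity.secTrueParity_aAut {ω : ℕ → Fin 3} {i : Fin 3} {χ : TreeAut → ZMod 2}
    (h : IsParity ω i χ) : secTrueParity χ aAut = 0 := h.map_one

theorem IsParity.secTrueParity_genAut {ω : ℕ → Fin 3} {i : Fin 3} {χ : TreeAut → ZMod 2}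
    (h : IsParity (shift ω) i χ) (j : Fin 3) :
    secTrueParity χ (genAut j ω) = if i = j then 0 else 1 := h.map_genAut j

theorem IsParity.secParity_genAut {ω : ℕ → Fin 3} {i : Fin 3} {χ : TreeAut → ZMod 2}
    (h : IsParity (shift ω) i χ) (j : Fin 3) :
    secParity χ (genAut j ω) = if i = j then 0 else 1 := by
  have h0 : χ (if ω 0 = j then 1 else aAut) = 0 := by
    split_ifs
    · exact h.map_one
    · exact h.map_aAut
  rw [secParity, sec_genAut_false, sec_genAut_true, h0, zero_add, h.map_genAut]

/-- The relations between the parities of the two sections of an element of `G_ω`. They say that the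
images of the sections in the dihedral group of order eight, the quotient of `G_{σω}` by the normal
closure of its generator with index `ω 0`, are exchanged by an outer automorphism. -/
structure SectionRelation (χ : TreeAut → ZMod 2) (g : TreeAut) : Prop where
  root : rootParity (sec g false) = secParity χ (sec g true)
  parity : secParity χ (sec g false) = rootParity (sec g true)
  trueParity : secTrueParity χ (sec g false) = secTrueParity χ (sec g true) +
    rootParity (sec g true) * secParity χ (sec g true) + rootParity (sec g true) +
    secParity χ (sec g true)

/-- The relation says that one section maps to the image of the other under an involutive
automorphism of the dihedral group. Being a homomorphism handles the case where `h` fixes the first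
level; being an involution handles the case where `h` swaps it. -/
theorem SectionRelation.mul {χ : TreeAut → ZMod 2} (hχ : ∀ g h, χ (g * h) = χ g + χ h)
    {g h : TreeAut} (hg : SectionRelation χ g) (hh : SectionRelation χ h) :
    SectionRelation χ (g * h) := by
  obtain ⟨g1, g2, g3⟩ := hg
  obtain ⟨h1, h2, h3⟩ := hh
  have e : ∀ b, sec (g * h) b = sec g (rt h b) * sec h b := sec_mul g h
  have et := e true
  have ef := e false
  rw [rt_true_eq_not] at et
  cases hf : rt h false <;> rw [hf] at et ef <;>
    simp only [Bool.not_false, Bool.not_true] at et ef <;> constructor <;>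
    simp only [et, ef, rootParity_mul, secParity_mul hχ, secTrueParity_mul hχ, g1, g2, g3, h1, h2,
      h3] <;>
    generalize rootParity (sec g true) = x <;> generalize rootParity (sec h true) = y <;>
    generalize secParity χ (sec g true) = z <;> generalize secParity χ (sec h true) = t <;>
    generalize secTrueParity χ (sec g true) = k <;>
    generalize secTrueParity χ (sec h true) = l <;> clear * - <;> revert x y z t k l <;> decide

/-- The sections of a generator with index other than `ω 0` are `a` and the generator of the same
index, whose images the outer automorphism exchanges. For `a` and the generator with index `ω 0`,
all sections have trivial image. -/
theorem sectionRelation_of_mem_G {ω : ℕ → Fin 3} {χ : TreeAut → ZMod 2}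
    (hχ : IsParity (shift (shift ω)) (ω 0) χ) {g : TreeAut} (hg : g ∈ G ω) :
    SectionRelation χ g := by
  have h0 : rootParity 1 = 0 := rfl
  refine G_induction (p := SectionRelation χ) ?_ ?_ (fun i => ?_)
    (fun g h _ _ hg hh => hg.mul hχ.map_mul hh) hg
  · constructor <;> simp [sec_one, h0, hχ.secParity_one, hχ.secTrueParity_one]
  · constructor <;> simp [sec_aAut, h0, hχ.secParity_one, hχ.secTrueParity_one]
  · have h1 : rootParity (genAut i (shift ω)) = 0 := rootParity_of_fixed (rt_genAut _ _ _)
    by_cases h : ω 0 = i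
    · constructor <;> simp [sec_genAut_true, sec_genAut_false, h, h0, h1, hχ.secParity_one,
        hχ.secTrueParity_one, hχ.secParity_genAut, hχ.secTrueParity_genAut]
    · constructor
      · simp [sec_genAut_true, sec_genAut_false, h, rootParity_aAut, hχ.secParity_genAut]
      · simp [sec_genAut_true, sec_genAut_false, h, h1, hχ.secParity_aAut]
      · simp only [sec_genAut_true, sec_genAut_false, h, h1, hχ.secTrueParity_aAut,
          hχ.secParity_genAut, hχ.secTrueParity_genAut, if_false]
        decide

/-! ## Stabilizers of half-lines -/

/-- The dihedral group of order eight generated by `a` and by the generator with index `ω 0`, which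
fixes `0^∞`. -/
def Dih (ω : ℕ → Fin 3) : Set TreeAut :=
  {g | ∀ b, sec g b = 1 ∨ sec g b = genAut (ω 0) (shift ω)}

theorem Dih_finite (ω : ℕ → Fin 3) : (Dih ω).Finite := by
  let S : Set TreeAut := {1, genAut (ω 0) (shift ω)}
  have hS : S.Finite := Set.toFinite _
  refine Set.Finite.of_finite_image
    (f := fun g => (rt g false, sec g false, sec g true)) ?_ ?_
  · apply (Set.finite_univ.prod (hS.prod hS)).subset
    rintro _ ⟨g, hg, rfl⟩
    exact ⟨Set.mem_univ _, hg false, hg true⟩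
  · intro g _ h _ e
    simp only [Prod.mk.injEq] at e
    refine treeAut_ext (fun b => ?_) (fun b => ?_)
    · rw [rt_eq_xor, e.1, ← rt_eq_xor]
    · cases b
      · exact e.2.1
      · exact e.2.2

/-- Both sections fix their first level, so the relation makes both values of `secParity χ` vanish.
Among the generators, only the one with index `ω 0` has this property. -/
theorem mem_Dih_of_sections {ω : ℕ → Fin 3} (hω : ∀ i, ω i ≠ ω (i + 1)) {g : TreeAut}
    (hg : g ∈ G ω) (hs : ∀ b, sec g b ∈ V4 (shift ω)) : g ∈ Dih ω := by
  obtain ⟨χ, hχ⟩ := exists_isParity (ω := shift (shift ω)) (hω 2) (ω 0)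
  have hrel := sectionRelation_of_mem_G hχ hg
  have hpar : ∀ b, secParity χ (sec g b) = 0 := by
    have h0 : ∀ b, rootParity (sec g b) = 0 := fun b => rootParity_of_fixed (rt_of_mem_V4 (hs b) _)
    rintro (_ | _)
    · rw [hrel.parity, h0]
    · rw [← hrel.root, h0]
  intro b
  have hb := hpar b
  rcases hs b with h | ⟨j, h⟩
  · exact Or.inl h
  · right
    rw [h, hχ.secParity_genAut] at hb
    by_cases hj : ω 0 = j
    · rw [h, hj]
    · rw [if_neg hj] at hb
      exact absurd hb (by decide)

/-- The relation forces the section at `0` to be `1` or `a` and decides between them exactly as in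
the definition of the generators. -/
theorem mem_V4_of_sections {ω : ℕ → Fin 3} (hω : ∀ i, ω i ≠ ω (i + 1)) {g : TreeAut}
    (hg : g ∈ G ω) (hrt : ∀ b, rt g b = b) (hf : sec g false ∈ Dih (shift ω))
    (ht : sec g true ∈ V4 (shift ω)) : g ∈ V4 ω := by
  obtain ⟨χ, hχ⟩ := exists_isParity (ω := shift (shift ω)) (hω 2) (ω 0)
  have hrel := sectionRelation_of_mem_G hχ hg
  have h0 : rootParity (sec g true) = 0 := rootParity_of_fixed (rt_of_mem_V4 ht _)
  -- The section at `0` of an element of `V4` is `1` or `a`, so it contributes nothing to `secParity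
  -- χ`. The right side of `trueParity` then becomes twice this common value.
  have hval : secTrueParity χ (sec g true) = secParity χ (sec g true) := by
    rcases ht with h | ⟨j, h⟩
    · rw [h, hχ.secTrueParity_one, hχ.secParity_one]
    · rw [h, hχ.secTrueParity_genAut, hχ.secParity_genAut]
  have h1 : χ (sec (sec g false) true) = 0 := by
    have h := hrel.trueParity
    rw [h0, hval, zero_mul, add_zero, add_zero, CharTwo.add_self_eq_zero] at h
    exact h
  have h2 : χ (sec (sec g false) false) = 0 := by
    have h := hrel.parity
    rw [h0, secParity, h1, add_zero] at h
    exact h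
  -- The only nontrivial section that `Dih` allows has index `ω 1`; since `ω 1 ≠ ω 0`, its parity is
  -- one, contrary to the two vanishing values just found.
  have hsec : ∀ b, sec (sec g false) b = 1 := by
    intro b
    rcases hf b with h | h
    · exact h
    · have hb : χ (sec (sec g false) b) = 0 := by
        cases b
        · exact h2
        · exact h1
      rw [h, hχ.map_genAut, if_neg (show ω 0 ≠ shift ω 0 from hω 0)] at hb
      exact absurd hb one_ne_zero
  have hone : rootParity (sec g false) = 0 → sec g false = 1 := by
    intro h
    refine treeAut_ext (fun b => ?_) hsec
    cases hr : rt (sec g false) false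
    · rw [rt_eq_xor, hr, Bool.xor_false]
      rfl
    · rw [rootParity, if_pos hr] at h
      exact absurd h one_ne_zero
  have ha : rootParity (sec g false) = 1 → sec g false = aAut := by
    intro h
    refine treeAut_ext (fun b => ?_) hsec
    cases hr : rt (sec g false) false
    · rw [rootParity, hr, if_neg Bool.false_ne_true] at h
      exact absurd h zero_ne_one
    · rw [rt_eq_xor, hr, Bool.xor_true]
      rfl
  have hroot := hrel.root
  rcases ht with h | ⟨j, h⟩
  · left
    rw [h, hχ.secParity_one] at hroot
    refine treeAut_ext hrt fun b => ?_
    cases b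
    · exact hone hroot
    · exact h
  · right
    refine ⟨j, treeAut_ext (fun b => by rw [hrt, rt_genAut]) fun b => ?_⟩
    rw [h, hχ.secParity_genAut] at hroot
    cases b
    · rw [sec_genAut_false]
      split_ifs at hroot ⊢
      · exact hone hroot
      · exact ha hroot
    · exact h

/-- The bounds `n + 1` and `n` are offset because the second claim at `n` uses the first claim at
the same `n` for the shifted sequence, and a section of a word of length zero can have length one.
-/
theorem mem_V4_and_mem_Dih_of_words (n : ℕ) : ∀ ω : ℕ → Fin 3, (∀ i, ω i ≠ ω (i + 1)) →
    (∀ g ∈ G ω, g ∈ Words ω (n + 1) → Pres LastEven g → g ∈ V4 ω) ∧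
    ∀ g ∈ G ω, g ∈ Words ω n → Pres ZeroOrLastEven g → g ∈ Dih ω := by
  induction n using Nat.strong_induction_on with
  | _ n ih =>
    have hV : ∀ ω : ℕ → Fin 3, (∀ i, ω i ≠ ω (i + 1)) → ∀ g ∈ G ω, g ∈ Words ω (n + 1) →
        Pres LastEven g → g ∈ V4 ω := by
      intro ω hω g hG hw hg
      have hω' : ∀ i, shift ω i ≠ shift ω (i + 1) := fun i => hω (i + 1)
      rcases words_eq_middle hw with h | ⟨s, hs, t, ht, h⟩
      · exact h
      have hsG := V4_le_G ω hs
      have htG := V4_le_G ω ht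
      have hpres : ∀ k, k ∈ G ω → g = s * k * t → Pres LastEven k := by
        rintro k hk rfl
        have e : k = s⁻¹ * (s * k * t) * t⁻¹ := by group
        rw [e]
        exact (((pres_lastEven_of_mem_V4 hs).inv hsG).mul hg hG).mul
          ((pres_lastEven_of_mem_V4 ht).inv htG) (inv_mem htG)
      rcases h with h | ⟨m, hm, k, hk, h⟩
      -- The core of the word would be `a` itself, which does not fix the first level.
      · have := rt_eq_of_pres_lastEven (aAut_mem_G ω) (hpres _ (aAut_mem_G ω) h) false
        exact absurd this (by decide)
      · have hkG : aAut * k * aAut ∈ G ω := by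
          have e : aAut * k * aAut = s⁻¹ * g * t⁻¹ := by rw [h]; group
          rw [e]
          exact mul_mem (mul_mem (inv_mem hsG) hG) (inv_mem htG)
        have hkp := hpres _ hkG h
        have hrt := rt_eq_of_pres_lastEven hkG hkp
        have e : ∀ b, sec (aAut * k * aAut) b = sec k (!b) := fun b => by
          rw [sec_mul, sec_mul, sec_aAut, sec_aAut, one_mul, mul_one, rt_aAut]
        have hsf := sec_mem_G hkG false
        have hst := sec_mem_G hkG true
        have hpf := pres_sec_lastEven_false hkG hkp (hrt false)
        have hpt := pres_sec_lastEven_true hkG hkp (hrt true)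
        have hwf : sec (aAut * k * aAut) false ∈ Words (shift ω) ((m + 1) / 2) := by
          rw [e]
          exact (sec_mem_words hk).1
        -- Conjugation by `a` exchanges the sections of `k`, and `(m + 2) / 2 = m / 2 + 1`. As `m +
        -- 2 ≤ n + 1`, both `(m + 1) / 2` and `m / 2` are smaller than `n`.
        have hwt : sec (aAut * k * aAut) true ∈ Words (shift ω) (m / 2 + 1) := by
          rw [e]
          exact words_mono _ (by omega) (sec_mem_words hk).2
        have hmem : aAut * k * aAut ∈ V4 ω := mem_V4_of_sections hω hkG hrt
          ((ih ((m + 1) / 2) (by omega) _ hω').2 _ hsf hwf hpf)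
          ((ih (m / 2) (by omega) _ hω').1 _ hst hwt hpt)
        rw [h]
        exact mul_mem (mul_mem hs hmem) ht
    intro ω hω
    refine ⟨hV ω hω, ?_⟩
    have hω' : ∀ i, shift ω i ≠ shift ω (i + 1) := fun i => hω (i + 1)
    intro g hG hw hg
    have hsw : ∀ b, sec g b ∈ Words (shift ω) (n + 1) := by
      rintro (_ | _)
      · exact words_mono _ (by omega) (sec_mem_words hw).2
      · exact words_mono _ (by omega) (sec_mem_words hw).1
    have key : ∀ k, k ∈ G ω → (∀ b, rt k b = b) → Pres ZeroOrLastEven k →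
        (∀ b, sec k b ∈ Words (shift ω) (n + 1)) → k ∈ Dih ω := fun k hk hrt hkp hkw =>
      mem_Dih_of_sections hω hk fun b =>
        hV _ hω' _ (sec_mem_G hk b) (hkw b) (pres_sec_zeroOrLastEven hk hkp (hrt b))
    cases hf : rt g false
    · exact key g hG (fun b => by rw [rt_eq_xor, hf, Bool.xor_false]) hg hsw
    -- Since `a` preserves `ΓPlus`, an element that swaps the first level may be multiplied by `a`.
    -- This only exchanges its sections, and `Dih` does not see the change.
    · have e : ∀ b, sec (g * aAut) b = sec g (!b) := fun b => by
        rw [sec_mul, sec_aAut, mul_one, rt_aAut]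
      have h := key (g * aAut) (mul_mem hG (aAut_mem_G ω))
        (fun b => by rw [rt_mul, rt_eq_xor, hf, rt_aAut, Bool.xor_true, Bool.not_not])
        (hg.mul pres_aAut (aAut_mem_G ω)) (fun b => by rw [e]; exact hsw _)
      intro b
      have hb := h (!b)
      rwa [e, Bool.not_not] at hb

theorem finite_pres_lastEven {ω : ℕ → Fin 3} (hω : ∀ i, ω i ≠ ω (i + 1)) :
    {g | g ∈ G ω ∧ Pres LastEven g}.Finite := by
  apply (V4_finite ω).subset
  rintro g ⟨hG, hg⟩
  obtain ⟨n, hn⟩ := exists_words hG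
  exact (mem_V4_and_mem_Dih_of_words n ω hω).1 g hG (words_mono ω n.le_succ hn) hg

theorem finite_pres_zeroOrLastEven {ω : ℕ → Fin 3} (hω : ∀ i, ω i ≠ ω (i + 1)) :
    {g | g ∈ G ω ∧ Pres ZeroOrLastEven g}.Finite := by
  apply (Dih_finite ω).subset
  rintro g ⟨hG, hg⟩
  obtain ⟨n, hn⟩ := exists_words hG
  exact (mem_V4_and_mem_Dih_of_words n ω hω).2 g hG hn hg

/-- The stabilizer of a set that agrees with a half-line outside a finite set is finite. -/
theorem finite_pres_of_agree (n : ℕ) : ∀ ω : ℕ → Fin 3, (∀ i, ω i ≠ ω (i + 1)) →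
    ∀ W : Boundary → Prop, (∀ x : Boundary, ∀ k ≥ n, IsLast x k → (W x ↔ LastEven x)) ∨
      (∀ x : Boundary, ∀ k ≥ n, IsLast x k → (W x ↔ ¬ LastEven x)) →
    {g | g ∈ G ω ∧ Pres W g}.Finite := by
  induction n with
  | zero =>
    intro ω hω
    have key : ∀ W : Boundary → Prop,
        (∀ x : Boundary, ∀ k ≥ 0, IsLast x k → (W x ↔ LastEven x)) →
        {g | g ∈ G ω ∧ Pres W g}.Finite := by
      intro W hW
      -- Every finitely supported sequence other than `0^∞` has a last `1`, so only the value of `W`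
      -- at `0^∞` is still free.
      by_cases h0 : W zeroBd
      · apply (finite_pres_zeroOrLastEven hω).subset
        rintro g ⟨hG, hg⟩
        refine ⟨hG, (pres_congr hG fun x hx => ?_).1 hg⟩
        by_cases hx0 : x = zeroBd
        · subst hx0
          exact iff_of_true h0 (Or.inl rfl)
        · obtain ⟨k, hk⟩ := exists_isLast hx hx0
          rw [ZeroOrLastEven, or_iff_right hx0]
          exact hW x k k.zero_le hk
      · apply (finite_pres_lastEven hω).subset
        rintro g ⟨hG, hg⟩
        refine ⟨hG, (pres_congr hG fun x hx => ?_).1 hg⟩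
        by_cases hx0 : x = zeroBd
        · subst hx0
          exact iff_of_false h0 not_lastEven_zeroBd
        · obtain ⟨k, hk⟩ := exists_isLast hx hx0
          exact hW x k k.zero_le hk
    rintro W (hW | hW)
    · exact key W hW
    · have h := key (fun x => ¬ W x) fun x k hk hx => by rw [hW x k hk hx, not_not]
      simpa only [pres_not] using h
  | succ n ih =>
    intro ω hω W hW
    have hω' : ∀ i, shift ω i ≠ shift ω (i + 1) := fun i => hω (i + 1)
    have hfin : ∀ b, {g | g ∈ G (shift ω) ∧ Pres (fun y => W (bcons b y)) g}.Finite := by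
      intro b
      apply ih _ hω'
      -- Deleting a letter turns agreement with the half-line into agreement with its complement and
      -- conversely; hence the disjunction in the statement.
      have hle : ∀ (y : Boundary) (k : ℕ), IsLast y k → (LastEven (bcons b y) ↔ ¬ LastEven y) := by
        intro y k hk
        refine lastEven_bcons ((Set.finite_le_nat k).subset fun m hm => ?_) ?_
        · by_contra hc
          exact Bool.false_ne_true ((hk.2 m (not_le.1 hc)).symm.trans hm)
        · rintro rfl
          exact Bool.false_ne_true hk.1
      rcases hW with hW | hW
      · right
        intro y k hk hy
        rw [hW _ (k + 1) (by omega) (isLast_bcons_succ.2 hy), hle y k hy]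
      · left
        intro y k hk hy
        rw [hW _ (k + 1) (by omega) (isLast_bcons_succ.2 hy), hle y k hy, not_not]
    have hfix : {g | (g ∈ G ω ∧ Pres W g) ∧ ∀ b, rt g b = b}.Finite := by
      refine Set.Finite.of_finite_image (f := fun g => (sec g false, sec g true)) ?_ ?_
      · apply ((hfin false).prod (hfin true)).subset
        rintro _ ⟨g, ⟨⟨hG, hg⟩, hrt⟩, rfl⟩
        exact ⟨⟨sec_mem_G hG _, pres_sec hg (hrt false)⟩, ⟨sec_mem_G hG _, pres_sec hg (hrt true)⟩⟩
      · rintro g ⟨-, hg⟩ h ⟨-, hh⟩ e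
        simp only [Prod.mk.injEq] at e
        refine treeAut_ext (fun b => by rw [hg, hh]) (fun b => ?_)
        cases b
        · exact e.1
        · exact e.2
    -- The elements fixing the first level have index at most two in the stabilizer, so one extra
    -- coset suffices.
    by_cases hex : ∃ g₀, (g₀ ∈ G ω ∧ Pres W g₀) ∧ rt g₀ false = true
    · obtain ⟨g₀, ⟨hG₀, hg₀⟩, hr₀⟩ := hex
      apply (hfix.union (hfix.image fun g => g₀ * g)).subset
      rintro g ⟨hG, hg⟩
      cases hf : rt g false
      · exact Or.inl ⟨⟨hG, hg⟩, fun b => by rw [rt_eq_xor, hf, Bool.xor_false]⟩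
      · refine Or.inr ⟨g₀⁻¹ * g, ⟨⟨mul_mem (inv_mem hG₀) hG, (hg₀.inv hG₀).mul hg hG⟩, ?_⟩,
          mul_inv_cancel_left g₀ g⟩
        have h0 : rt (g₀⁻¹ * g) false = false := by
          rw [rt_mul, hf, ← hr₀, rt_inv_rt]
        intro b
        rw [rt_eq_xor, h0, Bool.xor_false]
    · apply hfix.subset
      rintro g ⟨hG, hg⟩
      refine ⟨⟨hG, hg⟩, fun b => ?_⟩
      have h0 : rt g false = false := by
        by_contra hc
        exact hex ⟨g, ⟨hG, hg⟩, by simpa using hc⟩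
      rw [rt_eq_xor, h0, Bool.xor_false]

/-- The point stabilizers of the action of `G_ω` on `X` are finite. -/
theorem finite_stabilizer {ω : ℕ → Fin 3} (hω : ∀ i, ω i ≠ ω (i + 1)) (φ : X) :
    {g : G ω | g • φ = φ}.Finite := by
  -- An element fixing `φ` preserves each superlevel set of `φ`. The threshold `1/2` separates the
  -- values `0` and `1`, so this set agrees with `ΓPlus` wherever `φ` equals the indicator.
  let W : Boundary → Prop := fun x => ∃ hx : {n | x n = true}.Finite, 1 / 2 < φ.1 ⟨x, hx⟩
  have hW : ∀ x : V, W x.1 ↔ 1 / 2 < φ.1 x := fun x => ⟨fun ⟨_, h⟩ => h, fun h => ⟨x.2, h⟩⟩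
  -- `N` bounds the positions of all letters `1` in the finitely many sequences where `φ` differs
  -- from the indicator; a sequence with a `1` beyond `N` is not among them.
  obtain ⟨N, hN⟩ := (φ.finite_ne_indicator.biUnion
    (t := fun x : V => {n | x.1 n = true}) fun x _ => x.2).bddAbove
  have hagreeV : ∀ y : V, ∀ k ≥ N + 1, IsLast y.1 k → (W y.1 ↔ LastEven y.1) := by
    intro y k hk hy
    have heq : φ.1 y = ΓPlus.indicator 1 y := by
      by_contra hc
      have := hN (Set.mem_biUnion hc hy.1)
      omega
    have hy0 : y.1 ≠ zeroBd := fun h => Bool.false_ne_true ((congrFun h k).symm.trans hy.1)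
    have hmem : y ∈ ΓPlus ↔ LastEven y.1 := by
      rw [mem_ΓPlus_iff, ZeroOrLastEven, or_iff_right hy0]
    rw [hW, heq, ← hmem]
    by_cases h : y ∈ ΓPlus
    · simp only [h, Set.indicator_of_mem, Pi.one_apply, iff_true]
      norm_num
    · simp only [h, not_false_eq_true, Set.indicator_of_notMem, iff_false]
      norm_num
  have hagree : ∀ x : Boundary, ∀ k ≥ N + 1, IsLast x k → (W x ↔ LastEven x) := by
    intro x k hk hx
    refine hagreeV ⟨x, (Set.finite_le_nat k).subset fun m hm => ?_⟩ k hk hx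
    by_contra hc
    exact Bool.false_ne_true ((hx.2 m (not_le.1 hc)).symm.trans hm)
  refine Set.Finite.of_finite_image (f := Subtype.val) ?_ Subtype.val_injective.injOn
  apply (finite_pres_of_agree (N + 1) ω hω W (Or.inl hagree)).subset
  rintro _ ⟨g, hg, rfl⟩
  have key : ∀ y : V, W (g • y).1 ↔ W y.1 := by
    intro y
    have h := congrArg (fun ψ : X => ψ.1 (g • y)) (show g • φ = φ from hg)
    simp only [smul_apply_X, inv_smul_smul] at h
    rw [hW, hW, h]
  exact ⟨g.2, fun x hx => key ⟨x, hx⟩⟩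

end GrigorchukCube

theorem theoremT (ω : ℕ → Fin 3) (hω : ∀ i, ω i ≠ ω (i + 1)) :
    GrigorchukCube.IsModelEUnderline.{u} (GrigorchukCube.G ω) GrigorchukCube.X :=
  GrigorchukCube.isModelEUnderline_of_finite_stabilizers ω (GrigorchukCube.finite_stabilizer hω)
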